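/- Let $L, L_2, L_3>0$. For $0<L_1<L$ divide the box $(0,L)\times(0,L_2)\times(0,L_3)$ by a movable wall (the piston) at $x=L_1$ into the left chamber $(0,L_1)\times(0,L_2)\times(0,L_3)$ and the right chamber $(L_1,L)\times(0,L_2)\times(0,L_3)$. For a chamber $\Omega$, let $\lambda_1,\lambda_2,\dots$ be the eigenvalues of the Dirichlet Laplacian $-\Delta$ on $\Omega$, repeated according to multiplicity. Let $\zeta_\Omega$ be the meromorphic continuation of $\zeta_\Omega(s)=\sum_j\lambda_j^{-s}$ ($\operatorname{Re}s$ large), and let $\sum_j e^{-\lambda_j t}\sim\sum_{k=0,1/2,1,\dots}a_k(\Omega)\,t^{k-3/2}$ ($t\to0^+$) be the heat trace expansion. The zeta-regularized (zero temperature) Casimir energy of the free massless scalar field in $\Omega$ with Dirichlet boundary conditions, with arbitrary mass scale $m>0$, is $$E_{\Omega}=\tfrac12\,\mathrm{FP}\,\zeta_\Omega(-\tfrac12)-\frac{1}{2\sqrt{4\pi}}\,a_2(\Omega)\,\ln\big((m e/2)^2\big),$$ where $\mathrm{FP}$ denotes the finite part, i.e. the constant term of the Laurent expansion at a point which is at most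 a simple pole. For $\nu\in\mathbb R$ and $x>0$ put $K_\nu(x)=\frac12\left(\frac x2\right)^{\nu}\int_0^\infty e^{-t-x^2/(4t)}\,t^{-\nu-1}\,dt$, and put $\mu_{\ell_2\ell_3}=\sqrt{(\pi\ell_2/L_2)^2+(\pi\ell_3/L_3)^2}$. Then: 1. (Unambiguous energy.) For each of the two chambers the Casimir energy is well defined and does not depend on $m$; moreover $\zeta_\Omega$ has no pole at $s=-\frac12$, and $E_\Omega=\frac12\zeta_\Omega(-\frac12)$. 2. (Force.) Let $E^{\rm left}(L_1)$ and $E^{\rm right}(L_1)$ be the Casimir energies of the two chambers. The total energy $E^{\rm left}+E^{\rm right}$ is differentiable in $L_1\in(0,L)$, and the total force on the piston, $F(L_1)=-\frac{d}{dL_1}\big(E^{\rm left}+E^{\rm right}\big)(L_1)$, is given by $$F(L_1)=\frac1{2\pi}\sum_{\ell_1,\ell_2,\ell_3=1}^\infty\left|\frac{\mu_{\ell_2\ell_3}}{\ell_1}\right|\frac{\partial}{\partial L_1}K_1\big(2L_1\ell_1\mu_{\ell_2\ell_3}\big)+\frac1{2\pi}\sum_{\ell_1,\ell_2,\ell_3=1}^\infty\left|\frac{\mu_{\ell_2\ell_3}}{\ell_1}\right|\frac{\partial}{\partial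 L_1}K_1\big(2(L-L_1)\ell_1\mu_{\ell_2\ell_3}\big),$$ where both series converge absolutely. 3. (Attraction.) $K_1$ is differentiable and strictly decreasing on $(0,\infty)$, and the piston is attracted to the closer wall: $F(L_1)<0$ if $L_1<L-L_1$, and $F(L_1)>0$ if $L-L_1<L_1$. -/

import Mathlib

open Set Filter Topology Asymptotics
open scoped Laplacian InnerProductSpace

noncomputable section

/-- The modified Bessel function
`K_ν(x) = (1/2) (x/2)^ν ∫_0^∞ exp(-t - x²/(4t)) t^(-ν-1) dt` (for real `x > 0`). -/
def besselK (ν x : ℝ) : ℝ :=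
  (1 / 2) * (x / 2) ^ ν *
    ∫ t in Ioi (0 : ℝ), Real.exp (-t - x ^ 2 / (4 * t)) * t ^ (-ν - 1)

/-- The space of classical eigenfunctions of `-Δ` on the open set `Ω` with Dirichlet boundary
conditions and eigenvalue `c`: functions that are `C²` in `Ω` with `-Δ u = c u` there, continuous
up to the boundary and zero on the boundary.  (Every such function is extended by zero to the
complement of `Ω`; continuity up to the boundary with zero boundary values is continuity of this
extension.) -/
def dirichletEigenspace {d : ℕ} (Ω : Set (EuclideanSpace ℝ (Fin d))) (c : ℝ) :
    Submodule ℝ (EuclideanSpace ℝ (Fin d) → ℝ) where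
  carrier := {u | Continuous u ∧ (∀ x ∉ Ω, u x = 0) ∧
    ∀ x ∈ Ω, ContDiffAt ℝ 2 u x ∧ -(Δ u) x = c * u x}
  zero_mem' := by
    refine ⟨continuous_const, fun _ _ => rfl, fun x _ => ⟨contDiffAt_const, ?_⟩⟩
    have h : ContDiffAt ℝ 2 (0 : EuclideanSpace ℝ (Fin d) → ℝ) x := contDiffAt_const
    have := InnerProductSpace.laplacian_smul (0 : ℝ) h
    simp only [zero_smul] at this
    simp [this]
  add_mem' := by
    rintro u v ⟨hu, hu0, hu2⟩ ⟨hv, hv0, hv2⟩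
    refine ⟨hu.add hv, fun x hx => by simp [hu0 x hx, hv0 x hx], fun x hx => ?_⟩
    refine ⟨(hu2 x hx).1.add (hv2 x hx).1, ?_⟩
    rw [(hu2 x hx).1.laplacian_add (hv2 x hx).1, neg_add, (hu2 x hx).2, (hv2 x hx).2,
      Pi.add_apply, mul_add]
  smul_mem' := by
    rintro r u ⟨hu, hu0, hu2⟩
    refine ⟨hu.const_smul r, fun x hx => by simp [hu0 x hx], fun x hx => ?_⟩
    refine ⟨(hu2 x hx).1.const_smul r, ?_⟩
    rw [InnerProductSpace.laplacian_smul r (hu2 x hx).1, Pi.smul_apply, smul_eq_mul, smul_eq_mul,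
      ← mul_neg, (hu2 x hx).2]
    ring

/-- `lam 0, lam 1, …` lists the eigenvalues of the Dirichlet Laplacian `-Δ` on `Ω`, each one
repeated according to its multiplicity. -/
def IsDirichletSpectrum {d : ℕ} (Ω : Set (EuclideanSpace ℝ (Fin d))) (lam : ℕ → ℝ) : Prop :=
  ∀ c : ℝ, Module.rank ℝ (dirichletEigenspace Ω c) = Cardinal.mk {j : ℕ // lam j = c}

/-- `Z` is the meromorphic continuation to `ℂ` of the spectral zeta function
`ζ(s) = ∑_j lam_j^(-s)`, which converges for `Re s` large enough. (Values of `Z` at its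
poles are irrelevant.) -/
def IsZetaContinuation (lam : ℕ → ℝ) (Z : ℂ → ℂ) : Prop :=
  Meromorphic Z ∧ ∃ σ : ℝ, ∀ s : ℂ, σ < s.re → HasSum (fun j => (lam j : ℂ) ^ (-s)) (Z s)

/-- `Z(s₀ + ε) = R / ε + FP + o(1)` as `ε → 0`: residue `R` and finite part `FP` of a function
with at most a simple pole at `s₀`. -/
def HasResidueFinitePart (Z : ℂ → ℂ) (s₀ R FP : ℂ) : Prop :=
  Tendsto (fun s => Z s - R / (s - s₀)) (𝓝[≠] s₀) (𝓝 FP)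

/-- The heat trace `K(t) = ∑_j exp(-lam_j t)` converges for `t > 0` and has the full asymptotic
expansion `K(t) ~ ∑_{k = 0, 1/2, 1, …} a_k t^(k - d/2)` as `t → 0+`.  The heat kernel
coefficient `a_k` with half-integer index is `a (2 * k)` here. -/
def IsHeatExpansion (d : ℕ) (lam a : ℕ → ℝ) : Prop :=
  (∀ t : ℝ, 0 < t → Summable fun j => Real.exp (-lam j * t)) ∧
  ∀ N : ℕ,
    (fun t : ℝ => (∑' j, Real.exp (-lam j * t)) -
        ∑ n ∈ Finset.range N, a n * t ^ (((n : ℝ) - d) / 2))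
      =O[𝓝[>] 0] fun t : ℝ => t ^ (((N : ℝ) - d) / 2)

/-- `E` is the (zero temperature) zeta-regularized Casimir energy of a free massless scalar
field in the `d`-dimensional cavity `Ω` with Dirichlet boundary conditions, when `m > 0` is the
arbitrary mass scale of the regularization:
`E = (1/2) FP ζ(-1/2) - (1 / (2 √(4π))) a_{D/2} ln (m e / 2)²`, where `D = d + 1`, `ζ` is the
zeta function and `a_{D/2}` the heat kernel coefficient of the Dirichlet Laplacian on `Ω`. -/
def IsCasimirEnergy {d : ℕ} (Ω : Set (EuclideanSpace ℝ (Fin d))) (m E : ℝ) : Prop :=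
  ∃ (lam : ℕ → ℝ) (Z : ℂ → ℂ) (R FP : ℂ) (a : ℕ → ℝ),
    IsDirichletSpectrum Ω lam ∧ IsZetaContinuation lam Z ∧
    HasResidueFinitePart Z (-1 / 2) R FP ∧ IsHeatExpansion d lam a ∧
    (E : ℂ) = FP / 2 -
      ((1 / (2 * √(4 * Real.pi)) * a (d + 1) * Real.log ((m * Real.exp 1 / 2) ^ 2) : ℝ) : ℂ)

/-- The open box `(p, q) × (0, L₂) × (0, L₃)`. -/
def chamber (p q L₂ L₃ : ℝ) : Set (EuclideanSpace ℝ (Fin 3)) :=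
  {x | x 0 ∈ Ioo p q ∧ x 1 ∈ Ioo 0 L₂ ∧ x 2 ∈ Ioo 0 L₃}

/-- `μ_{ℓ₂ ℓ₃} = √((π ℓ₂ / L₂)² + (π ℓ₃ / L₃)²)`. -/
def crossMu (L₂ L₃ : ℝ) (ℓ₂ ℓ₃ : ℕ+) : ℝ :=
  √((Real.pi * ℓ₂ / L₂) ^ 2 + (Real.pi * ℓ₃ / L₃) ^ 2)

end

/-! The Dirichlet eigenvalues of a box are sums of interval eigenvalues, so its heat trace is a
product of three interval traces. Jacobi's theta inversion writes the trace of the variable edge `a`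
as `a/(2√π) t^(-1/2) - 1/2` plus a remainder that is flat at `t = 0` (`heatTr_eq`). With `ξ` the
continued Mellin transform of the cross-section trace, this yields `Γ(s) ζ(s) = a/(2√π) ξ(s - 1/2) -
ξ(s)/2 + B(s)` with `B` entire. The poles of `ξ` lie in `{0, 1/2, 1}`, so `ζ` is regular at `-1/2`.
Half its value there is `α a + β - S(a)/(2π)`, where `α` and `β` depend on the cross-section only
and `S` is the `K₁` lattice sum found by integrating `B(-1/2)` termwise (`exists_zeta_box`,
`integral_heatRem_mul_heatTr`).

The heat expansion of a box stops after four terms, so the coefficient multiplying the logarithm is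
zero and `m` drops out. The variable edges of the two chambers add up to `L`, so `α` cancels in the
force. What remains is a difference of values of one strictly decreasing function at `L₁` and `L -
L₁`, which gives the sign.

The spectrum is specified through dimensions of spaces of classical eigenfunctions, so these must be
computed (`rank_dirichletEigenspace_openBox`). Green's identity makes an eigenfunction orthogonal to
every sine product with another eigenvalue, and Stone–Weierstrass makes the sine products complete.
Uniqueness of meromorphic continuations and of heat coefficients removes the dependence on the
chosen data. -/

open MeasureTheory


/-! ### The modified Bessel function `K₁` -/

/-- The integrand of the symmetric integral representation of `K₁` and its derivatives. -/
noncomputable def besselKer (k : ℕ) (z s : ℝ) : ℝ :=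
  (s + s⁻¹) ^ k * (s ^ 2)⁻¹ * Real.exp (-(z / 2 * (s + s⁻¹)))

theorem besselKer_pos (k : ℕ) (z : ℝ) {s : ℝ} (hs : 0 < s) : 0 < besselKer k z s := by
  unfold besselKer; positivity

/-- The source of every decay estimate below, for Bessel integrals and theta sums alike: polynomial
decay of arbitrary order is all that is needed. -/
theorem exp_neg_le_factorial_div_pow {y : ℝ} (hy : 0 < y) (N : ℕ) :
    Real.exp (-y) ≤ N.factorial / y ^ N := by
  rw [Real.exp_neg, inv_le_comm₀ (Real.exp_pos y) (by positivity), inv_div]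
  exact Real.pow_div_factorial_le_exp y hy.le N

/-- With `w = s + 1/s` one has `w s = 1 + s²` and `w ≥ 1`. Bounding the exponential by a power of
`1/(z w)` leaves `(w s)^(-2) w^(-j)`, so a single bound gives integrability in `s` and decay of
order `N` in `z`. -/
theorem besselKer_le {k N : ℕ} (h : k + 2 ≤ N) {z s : ℝ} (hz : 0 < z) (hs : 0 < s) :
    besselKer k z s ≤ N.factorial * 2 ^ N / z ^ N * (1 + s ^ 2)⁻¹ := by
  obtain ⟨j, rfl⟩ := Nat.exists_eq_add_of_le h
  set w := s + s⁻¹ with hw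
  have hsi : 0 < s⁻¹ := inv_pos.2 hs
  have hss : s * s⁻¹ = 1 := mul_inv_cancel₀ hs.ne'
  have hw0 : 0 < w := by positivity
  have hw1 : 1 ≤ w := by nlinarith [sq_nonneg (s - s⁻¹)]
  have hws : w * s = 1 + s ^ 2 := by rw [hw]; field_simp; ring
  have h1 : besselKer k z s ≤ w ^ k * (s ^ 2)⁻¹ *
      ((k + 2 + j).factorial / (z / 2 * w) ^ (k + 2 + j)) := by
    unfold besselKer
    gcongr
    exact exp_neg_le_factorial_div_pow (by positivity) _
  refine h1.trans ?_
  have h2 : w ^ k * (s ^ 2)⁻¹ * ((k + 2 + j).factorial / (z / 2 * w) ^ (k + 2 + j)) =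
      (k + 2 + j).factorial * 2 ^ (k + 2 + j) / z ^ (k + 2 + j) *
        (((w * s) ^ 2)⁻¹ * (w ^ j)⁻¹) := by
    have : w ^ (k + 2 + j) = w ^ k * w ^ 2 * w ^ j := by rw [pow_add, pow_add]
    rw [mul_pow, div_pow, this]
    field_simp
  rw [h2, hws]
  gcongr
  have h3 : (w ^ j)⁻¹ ≤ 1 := inv_le_one_of_one_le₀ (one_le_pow₀ hw1)
  have h4 : ((1 + s ^ 2) ^ 2)⁻¹ ≤ (1 + s ^ 2)⁻¹ := by
    gcongr
    nlinarith [sq_nonneg s]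
  calc _ ≤ (1 + s ^ 2)⁻¹ * 1 := by gcongr
    _ = _ := mul_one _

theorem measurable_besselKer (k : ℕ) (z : ℝ) : Measurable (besselKer k z) := by
  unfold besselKer; fun_prop

theorem integrableOn_besselKer (k : ℕ) {z : ℝ} (hz : 0 < z) :
    IntegrableOn (besselKer k z) (Ioi 0) := by
  refine Integrable.mono' ((integrable_inv_one_add_sq.integrableOn (s := Ioi 0)).const_mul
    ((k + 2).factorial * 2 ^ (k + 2) / z ^ (k + 2)))
    (measurable_besselKer k z).aestronglyMeasurable ?_
  filter_upwards [ae_restrict_mem measurableSet_Ioi] with s hs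
  rw [Real.norm_of_nonneg (besselKer_pos k z hs).le]
  exact besselKer_le le_rfl hz hs

/-- The integrals `∫_0^∞ (s + 1/s)^k s^(-2) exp(-z (s + 1/s) / 2) ds`. -/
noncomputable def besselInt (k : ℕ) (z : ℝ) : ℝ := ∫ s in Ioi (0 : ℝ), besselKer k z s

theorem integral_pos_of_pos_Ioi {f : ℝ → ℝ} (hf : IntegrableOn f (Ioi 0))
    (hpos : ∀ s ∈ Ioi (0 : ℝ), 0 < f s) : 0 < ∫ s in Ioi (0 : ℝ), f s := by
  rw [setIntegral_pos_iff_support_of_nonneg_ae _ hf]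
  · have : Function.support f ∩ Ioi 0 = Ioi 0 :=
      inter_eq_right.2 fun s hs => (hpos s hs).ne'
    simp [this]
  · filter_upwards [ae_restrict_mem measurableSet_Ioi] with s hs using (hpos s hs).le

theorem besselInt_pos (k : ℕ) {z : ℝ} (hz : 0 < z) : 0 < besselInt k z :=
  integral_pos_of_pos_Ioi (integrableOn_besselKer k hz) fun _ hs => besselKer_pos k z hs

theorem strictAntiOn_besselInt (k : ℕ) : StrictAntiOn (besselInt k) (Ioi 0) := by
  intro a ha b hb hab
  have := integral_pos_of_pos_Ioi
    ((integrableOn_besselKer k ha).sub (integrableOn_besselKer k hb)) fun s hs => by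
      have hs : 0 < s := hs
      have h2 : Real.exp (-(b / 2 * (s + s⁻¹))) < Real.exp (-(a / 2 * (s + s⁻¹))) := by
        gcongr
      rw [Pi.sub_apply, sub_pos]
      unfold besselKer
      gcongr
  simp only [Pi.sub_apply] at this
  rw [integral_sub (integrableOn_besselKer k ha) (integrableOn_besselKer k hb)] at this
  exact sub_pos.1 this

theorem exists_besselInt_le (k N : ℕ) (h : k + 2 ≤ N) :
    ∃ C : ℝ, 0 < C ∧ ∀ z : ℝ, 0 < z → besselInt k z ≤ C / z ^ N := by
  refine ⟨N.factorial * 2 ^ N * Real.pi, by positivity, fun z hz => ?_⟩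
  have h1 : besselInt k z ≤ ∫ s in Ioi (0 : ℝ), N.factorial * 2 ^ N / z ^ N * (1 + s ^ 2)⁻¹ := by
    refine setIntegral_mono_on (integrableOn_besselKer k hz)
      ((integrable_inv_one_add_sq.integrableOn).const_mul _) measurableSet_Ioi
      fun s hs => besselKer_le h hz hs
  refine h1.trans ?_
  rw [integral_const_mul]
  have h2 : ∫ s in Ioi (0 : ℝ), (1 + s ^ 2)⁻¹ ≤ Real.pi := by
    rw [← integral_univ_inv_one_add_sq]
    exact setIntegral_le_integral integrable_inv_one_add_sq
      (Eventually.of_forall fun s => by positivity)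
  calc _ ≤ N.factorial * 2 ^ N / z ^ N * Real.pi := by gcongr
    _ = _ := by ring

/-- Differentiation under the integral sign. On the neighbourhood `(z/2, ∞)` the bound
`besselKer_le` is uniform once its `z` is replaced by `z/2`. -/
theorem hasDerivAt_besselInt (k : ℕ) {z : ℝ} (hz : 0 < z) :
    HasDerivAt (besselInt k) (-(1 / 2) * besselInt (k + 1) z) z := by
  have key := hasDerivAt_integral_of_dominated_loc_of_deriv_le
    (μ := volume.restrict (Ioi (0 : ℝ))) (F := besselKer k)
    (F' := fun z s => -(1 / 2) * besselKer (k + 1) z s)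
    (bound := fun s => 1 / 2 * ((k + 1 + 2).factorial * 2 ^ (k + 1 + 2) / (z / 2) ^ (k + 1 + 2) *
      (1 + s ^ 2)⁻¹)) (x₀ := z) (s := Ioi (z / 2)) (Ioi_mem_nhds (by linarith))
    (Eventually.of_forall fun y => (measurable_besselKer k y).aestronglyMeasurable)
    (integrableOn_besselKer k hz)
    ((measurable_besselKer (k + 1) z).const_mul _).aestronglyMeasurable
    ?_ (((integrable_inv_one_add_sq.integrableOn).const_mul _).const_mul _) ?_
  · rw [besselInt, ← integral_const_mul]
    exact key.2
  · filter_upwards [ae_restrict_mem measurableSet_Ioi] with s hs y hy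
    have hy' : z / 2 < y := hy
    have hy0 : 0 < y := by linarith
    rw [norm_mul, Real.norm_of_nonneg (besselKer_pos _ y hs).le, norm_neg,
      Real.norm_of_nonneg (by norm_num)]
    have h1 := besselKer_le (k := k + 1) le_rfl hy0 hs
    have h2 : 0 < s := hs
    refine mul_le_mul_of_nonneg_left (h1.trans ?_) (by norm_num)
    gcongr
  · filter_upwards [ae_restrict_mem measurableSet_Ioi] with s hs y _
    unfold besselKer
    have h : HasDerivAt (fun y : ℝ => -(y / 2 * (s + s⁻¹))) (-(1 / 2 * (s + s⁻¹))) y :=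
      (((hasDerivAt_id y).div_const 2).mul_const _).neg
    exact (h.exp.const_mul ((s + s⁻¹) ^ k * (s ^ 2)⁻¹)).congr_deriv (by ring)

/-- The substitution `s = (b/a) t` symmetrizes `a²/t + b² t` into `a b (s + 1/s)`. The case `a =
z/2`, `b = 1` is the defining integral of `K₁`; the case of an edge multiple and `crossMu` is a
single term of the Mellin integral at `-1/2`. -/
theorem besselInt_scaling {a b : ℝ} (ha : 0 < a) (hb : 0 < b) :
    IntegrableOn (fun t : ℝ => (t ^ 2)⁻¹ * Real.exp (-(a ^ 2 / t) - b ^ 2 * t)) (Ioi 0) ∧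
    ∫ t in Ioi (0 : ℝ), (t ^ 2)⁻¹ * Real.exp (-(a ^ 2 / t) - b ^ 2 * t) =
      b / a * besselInt 0 (2 * a * b) := by
  have hc : 0 < b / a := by positivity
  have heq : ∀ t ∈ Ioi (0 : ℝ), (t ^ 2)⁻¹ * Real.exp (-(a ^ 2 / t) - b ^ 2 * t) =
      (b / a) ^ 2 * besselKer 0 (2 * a * b) (b / a * t) := by
    intro t ht
    have ht : 0 < t := ht
    have h1 : -(a ^ 2 / t) - b ^ 2 * t =
        -(2 * a * b / 2 * (b / a * t + (b / a * t)⁻¹)) := by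
      field_simp; ring
    unfold besselKer
    rw [h1]
    field_simp
  constructor
  · rw [integrableOn_congr_fun heq measurableSet_Ioi]
    refine Integrable.const_mul ?_ _
    have := (integrableOn_Ioi_comp_mul_left_iff (besselKer 0 (2 * a * b)) 0 hc).2
      (by rw [mul_zero]; exact integrableOn_besselKer 0 (by positivity))
    exact this
  · rw [setIntegral_congr_fun measurableSet_Ioi heq, integral_const_mul,
      integral_comp_mul_left_Ioi _ _ hc, mul_zero, besselInt, smul_eq_mul]
    field_simp

theorem besselK_one_eq {z : ℝ} (hz : 0 < z) : besselK 1 z = 1 / 2 * besselInt 0 z := by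
  have h := (besselInt_scaling (a := z / 2) (b := 1) (by positivity) one_pos).2
  have heq : ∀ t ∈ Ioi (0 : ℝ), Real.exp (-t - z ^ 2 / (4 * t)) * t ^ (-1 - 1 : ℝ) =
      (t ^ 2)⁻¹ * Real.exp (-((z / 2) ^ 2 / t) - 1 ^ 2 * t) := by
    intro t ht
    have ht : 0 < t := ht
    rw [show (-1 - 1 : ℝ) = -((2 : ℕ) : ℝ) by norm_num, Real.rpow_neg ht.le, Real.rpow_natCast,
      mul_comm]
    congr 2
    field_simp
    ring
  rw [besselK, Real.rpow_one, setIntegral_congr_fun measurableSet_Ioi heq, h]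
  have : 2 * (z / 2) * 1 = z := by ring
  rw [this]
  field_simp

theorem hasDerivAt_besselK_one {z : ℝ} (hz : 0 < z) :
    HasDerivAt (besselK 1) (-(1 / 4) * besselInt 1 z) z := by
  have h := (hasDerivAt_besselInt 0 hz).const_mul (1 / 2)
  have h2 : besselK 1 =ᶠ[𝓝 z] fun z => 1 / 2 * besselInt 0 z := by
    filter_upwards [Ioi_mem_nhds hz] with y hy using besselK_one_eq hy
  refine (h.congr_of_eventuallyEq h2).congr_deriv ?_
  ring

theorem strictAntiOn_besselK_one : StrictAntiOn (besselK 1) (Ioi 0) := by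
  intro a ha b hb hab
  rw [besselK_one_eq ha, besselK_one_eq hb]
  have := strictAntiOn_besselInt 0 ha hb hab
  linarith

/-! ### Functions that are flat at `0` or rapidly decaying at infinity -/

/-- `f(t) = O(t^M)` as `t → 0+` for every `M`. -/
def FlatAtZero (f : ℝ → ℝ) : Prop := ∀ M : ℝ, f =O[𝓝[>] 0] fun t : ℝ => t ^ M

/-- `f(t) = O(t^(-M))` as `t → ∞` for every `M`. -/
def RapidAtTop (f : ℝ → ℝ) : Prop := ∀ M : ℝ, f =O[atTop] fun t : ℝ => t ^ (-M)

theorem isBigO_rpow_mul_zero {f g : ℝ → ℝ} {a b : ℝ} (hf : f =O[𝓝[>] 0] fun t : ℝ => t ^ a)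
    (hg : g =O[𝓝[>] 0] fun t : ℝ => t ^ b) :
    (fun t => f t * g t) =O[𝓝[>] 0] fun t : ℝ => t ^ (a + b) := by
  refine (hf.mul hg).congr' EventuallyEq.rfl ?_
  filter_upwards [self_mem_nhdsWithin] with t ht
  exact (Real.rpow_add ht a b).symm

theorem isBigO_rpow_rpow_zero {a b : ℝ} (h : a ≤ b) :
    (fun t : ℝ => t ^ b) =O[𝓝[>] 0] fun t : ℝ => t ^ a := by
  refine IsBigO.of_bound 1 ?_
  filter_upwards [Ioo_mem_nhdsGT one_pos] with t ht
  rw [one_mul, Real.norm_of_nonneg (Real.rpow_nonneg ht.1.le _),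
    Real.norm_of_nonneg (Real.rpow_nonneg ht.1.le _)]
  exact Real.rpow_le_rpow_of_exponent_ge ht.1 ht.2.le h

theorem isBigO_rpow_rpow_atTop {a b : ℝ} (h : a ≤ b) :
    (fun t : ℝ => t ^ a) =O[atTop] fun t : ℝ => t ^ b := by
  refine IsBigO.of_bound 1 ?_
  filter_upwards [eventually_ge_atTop 1] with t ht
  rw [one_mul, Real.norm_of_nonneg (Real.rpow_nonneg (by linarith) _),
    Real.norm_of_nonneg (Real.rpow_nonneg (by linarith) _)]
  exact Real.rpow_le_rpow_of_exponent_le ht h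

theorem FlatAtZero.add {f g : ℝ → ℝ} (hf : FlatAtZero f) (hg : FlatAtZero g) :
    FlatAtZero fun t => f t + g t := fun M => (hf M).add (hg M)

theorem FlatAtZero.mul_isBigO {f g : ℝ → ℝ} (hf : FlatAtZero f) {b : ℝ}
    (hg : g =O[𝓝[>] 0] fun t : ℝ => t ^ b) : FlatAtZero fun t => f t * g t := fun M => by
  simpa using isBigO_rpow_mul_zero (hf (M - b)) hg

theorem FlatAtZero.congr {f g : ℝ → ℝ} (hf : FlatAtZero f) (h : ∀ t, 0 < t → f t = g t) :
    FlatAtZero g := fun M => (hf M).congr' (by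
      filter_upwards [self_mem_nhdsWithin] with t ht using h t ht) EventuallyEq.rfl

theorem RapidAtTop.mul_isBigO {f g : ℝ → ℝ} (hf : RapidAtTop f) {b : ℝ}
    (hg : g =O[atTop] fun t : ℝ => t ^ b) : RapidAtTop fun t => f t * g t := fun M => by
  refine ((hf (M + b)).mul hg).congr' EventuallyEq.rfl ?_
  filter_upwards [eventually_gt_atTop 0] with t ht
  rw [← Real.rpow_add ht]
  congr 1
  ring

theorem FlatAtZero.of_le {f : ℝ → ℝ} {b : ℝ}
    (h : ∀ N : ℕ, 1 ≤ N → ∃ C, ∀ t, 0 < t → |f t| ≤ C * t ^ ((N : ℝ) + b)) : FlatAtZero f := by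
  intro M
  obtain ⟨N, hN⟩ := exists_nat_ge (M - b)
  obtain ⟨C, hC⟩ := h (N + 1) (by omega)
  have h1 : f =O[𝓝[>] 0] fun t : ℝ => t ^ (((N + 1 : ℕ) : ℝ) + b) := by
    refine IsBigO.of_bound C ?_
    filter_upwards [self_mem_nhdsWithin] with t ht
    rw [Real.norm_of_nonneg (Real.rpow_nonneg (le_of_lt ht) _)]
    exact hC t ht
  refine h1.trans (isBigO_rpow_rpow_zero ?_)
  push_cast
  linarith

theorem RapidAtTop.of_le {f : ℝ → ℝ}
    (h : ∀ N : ℕ, 1 ≤ N → ∃ C, ∀ t, 0 < t → |f t| ≤ C / t ^ N) : RapidAtTop f := by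
  intro M
  obtain ⟨N, hN⟩ := exists_nat_ge M
  obtain ⟨C, hC⟩ := h (N + 1) (by omega)
  have h1 : f =O[atTop] fun t : ℝ => t ^ (-((N + 1 : ℕ) : ℝ)) := by
    refine IsBigO.of_bound C ?_
    filter_upwards [eventually_gt_atTop 0] with t ht
    rw [Real.norm_of_nonneg (Real.rpow_nonneg (le_of_lt ht) _), Real.rpow_neg ht.le,
      Real.rpow_natCast, ← div_eq_mul_inv]
    exact hC t ht
  refine h1.trans (isBigO_rpow_rpow_atTop ?_)
  push_cast
  linarith

/-! ### One-dimensional heat traces -/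

/-- `∑_{n ≥ 1} exp(-n² y)`. -/
noncomputable def expSqSum (y : ℝ) : ℝ := ∑' n : ℕ+, Real.exp (-((n : ℝ) ^ 2 * y))

theorem exp_sq_le (n : ℕ+) {y : ℝ} (hy : 0 < y) (N : ℕ) :
    Real.exp (-((n : ℝ) ^ 2 * y)) ≤ N.factorial / y ^ N * ((n : ℝ) ^ (2 * N))⁻¹ := by
  have hn : 0 < (n : ℝ) := by exact_mod_cast n.pos
  refine (exp_neg_le_factorial_div_pow (by positivity) N).trans (le_of_eq ?_)
  rw [mul_pow, pow_mul]
  field_simp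

theorem summable_pnat_pow_inv {N : ℕ} (hN : 2 ≤ N) : Summable fun n : ℕ+ => ((n : ℝ) ^ N)⁻¹ :=
  (Real.summable_nat_pow_inv.2 hN).comp_injective PNat.coe_injective

theorem summable_exp_sq {y : ℝ} (hy : 0 < y) :
    Summable fun n : ℕ+ => Real.exp (-((n : ℝ) ^ 2 * y)) :=
  Summable.of_nonneg_of_le (fun _ => (Real.exp_pos _).le) (fun n => exp_sq_le n hy 1)
    ((summable_pnat_pow_inv (by norm_num)).mul_left _)

theorem expSqSum_nonneg (y : ℝ) : 0 ≤ expSqSum y := tsum_nonneg fun _ => (Real.exp_pos _).le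

theorem exists_expSqSum_le (N : ℕ) (hN : 1 ≤ N) :
    ∃ C, 0 ≤ C ∧ ∀ y, 0 < y → expSqSum y ≤ C / y ^ N := by
  refine ⟨N.factorial * ∑' n : ℕ+, ((n : ℝ) ^ (2 * N))⁻¹,
    mul_nonneg (by positivity) (tsum_nonneg fun _ => by positivity), fun y hy => ?_⟩
  have hs := summable_pnat_pow_inv (N := 2 * N) (by omega)
  calc expSqSum y ≤ ∑' n : ℕ+, N.factorial / y ^ N * ((n : ℝ) ^ (2 * N))⁻¹ :=
        (summable_exp_sq hy).tsum_le_tsum (fun n => exp_sq_le n hy N) (hs.mul_left _)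
    _ = _ := by rw [tsum_mul_left]; ring

theorem continuousOn_expSqSum : ContinuousOn expSqSum (Ioi 0) := by
  intro y hy
  have hy : 0 < y := hy
  have h : ContinuousOn expSqSum (Ioi (y / 2)) := by
    refine continuousOn_tsum (u := fun n : ℕ+ => Real.exp (-((n : ℝ) ^ 2 * (y / 2))))
      (fun n => by fun_prop) (summable_exp_sq (by positivity)) fun n x hx => ?_
    have hx : y / 2 < x := hx
    rw [Real.norm_of_nonneg (Real.exp_pos _).le]
    gcongr
  exact (h.continuousAt (Ioi_mem_nhds (by linarith))).continuousWithinAt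

theorem tsum_int_exp_sq {b : ℝ} (hb : 0 < b) :
    ∑' n : ℤ, Real.exp (-b * (n : ℝ) ^ 2) = 1 + 2 * expSqSum b := by
  have hp : (fun n : ℕ+ => Real.exp (-b * ((n : ℤ) : ℝ) ^ 2)) =
      fun n : ℕ+ => Real.exp (-((n : ℝ) ^ 2 * b)) := by
    ext n; congr 1; push_cast; ring
  have hs : HasSum (fun n : ℕ+ => Real.exp (-b * ((n : ℤ) : ℝ) ^ 2)) (expSqSum b) := by
    rw [hp]; exact (summable_exp_sq hb).hasSum
  have hs1 : HasSum (fun n : ℕ => Real.exp (-b * (((n : ℤ) + 1 : ℤ) : ℝ) ^ 2)) (expSqSum b) := by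
    rw [← Equiv.pnatEquivNat.hasSum_iff]
    convert hs using 2 with n
    simp only [Function.comp, Equiv.pnatEquivNat_apply]
    have : ((n.natPred : ℤ) + 1 : ℤ) = (n : ℤ) := by exact_mod_cast n.natPred_add_one
    rw [this]
  have hs2 : HasSum (fun n : ℕ => Real.exp (-b * ((-((n : ℤ) + 1) : ℤ) : ℝ) ^ 2))
      (expSqSum b) := by
    convert hs1 using 4
    push_cast
    ring
  have := HasSum.of_add_one_of_neg_add_one (f := fun n : ℤ => Real.exp (-b * (n : ℝ) ^ 2))
    hs1 hs2
  rw [this.tsum_eq]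
  simp
  ring

/-- The remainder in the small time expansion of the heat trace of an interval. -/
noncomputable def heatRem (a t : ℝ) : ℝ := a / √Real.pi * (t ^ (-(1 / 2) : ℝ) * expSqSum (a ^ 2 / t))

/-- The heat trace of the Dirichlet Laplacian on an interval of length `a`. -/
noncomputable def heatTr (a t : ℝ) : ℝ := expSqSum ((Real.pi / a) ^ 2 * t)

/-- Poisson summation at parameter `π t / a²`. The zero mode on the dual side gives the `t^(-1/2)`
term, the `n = 0` term on the original side gives `-1/2`, and the nonzero dual modes form `heatRem`.
-/
theorem heatTr_eq {a t : ℝ} (ha : 0 < a) (ht : 0 < t) :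
    heatTr a t = a / √Real.pi / 2 * t ^ (-(1 / 2) : ℝ) - 1 / 2 + heatRem a t := by
  have hpi := Real.pi_pos
  have hα : 0 < Real.pi * t / a ^ 2 := by positivity
  have h := Real.tsum_exp_neg_mul_int_sq hα
  have e1 : -Real.pi * (Real.pi * t / a ^ 2) = -((Real.pi / a) ^ 2 * t) := by
    field_simp
  have e2 : -Real.pi / (Real.pi * t / a ^ 2) = -(a ^ 2 / t) := by field_simp
  have e3 : 1 / (Real.pi * t / a ^ 2) ^ (1 / 2 : ℝ) = a / √Real.pi * t ^ (-(1 / 2) : ℝ) := by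
    rw [Real.div_rpow (by positivity) (by positivity), Real.mul_rpow hpi.le ht.le,
      ← Real.sqrt_eq_rpow, ← Real.sqrt_eq_rpow (a ^ 2), Real.sqrt_sq ha.le, Real.rpow_neg ht.le]
    field_simp
  rw [e1, e2, e3, tsum_int_exp_sq (by positivity), tsum_int_exp_sq (by positivity)] at h
  unfold heatTr heatRem
  linarith

theorem heatTr_nonneg (a t : ℝ) : 0 ≤ heatTr a t := expSqSum_nonneg _

theorem continuousOn_heatTr {a : ℝ} (ha : 0 < a) : ContinuousOn (heatTr a) (Ioi 0) := by
  refine continuousOn_expSqSum.comp (by fun_prop) fun t ht => ?_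
  have ht : 0 < t := ht
  have := Real.pi_pos
  exact mem_Ioi.2 (by positivity)

theorem continuousOn_heatRem {a : ℝ} (ha : 0 < a) : ContinuousOn (heatRem a) (Ioi 0) := by
  refine continuousOn_const.mul (ContinuousOn.mul ?_ (continuousOn_expSqSum.comp ?_ ?_))
  · exact fun t ht => (Real.continuousAt_rpow_const _ _ (Or.inl (ne_of_gt ht))).continuousWithinAt
  · exact continuousOn_const.div continuousOn_id fun t ht => ne_of_gt ht
  · intro t ht
    have ht : 0 < t := ht
    exact mem_Ioi.2 (by positivity)

theorem rapidAtTop_heatTr {a : ℝ} (ha : 0 < a) : RapidAtTop (heatTr a) := by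
  refine RapidAtTop.of_le fun N hN => ?_
  obtain ⟨C, -, hC⟩ := exists_expSqSum_le N hN
  have := Real.pi_pos
  refine ⟨C / ((Real.pi / a) ^ 2) ^ N, fun t ht => ?_⟩
  rw [abs_of_nonneg (heatTr_nonneg a t)]
  refine (hC _ (by positivity)).trans (le_of_eq ?_)
  rw [mul_pow, div_div]

theorem abs_heatRem_le {a : ℝ} (ha : 0 < a) (N : ℕ) (hN : 1 ≤ N) :
    ∃ C, ∀ t, 0 < t → |heatRem a t| ≤ C * t ^ ((N : ℝ) + -(1 / 2)) := by
  obtain ⟨C, -, hC⟩ := exists_expSqSum_le N hN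
  refine ⟨a / √Real.pi * (C / (a ^ 2) ^ N), fun t ht => ?_⟩
  have h0 : 0 ≤ heatRem a t := by
    unfold heatRem
    have := expSqSum_nonneg (a ^ 2 / t)
    positivity
  rw [abs_of_nonneg h0, Real.rpow_add ht, Real.rpow_natCast]
  unfold heatRem
  have h1 := hC (a ^ 2 / t) (by positivity)
  calc _ ≤ a / √Real.pi * (t ^ (-(1 / 2) : ℝ) * (C / (a ^ 2 / t) ^ N)) := by gcongr
    _ = _ := by rw [div_pow]; field_simp

theorem flatAtZero_heatRem {a : ℝ} (ha : 0 < a) : FlatAtZero (heatRem a) :=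
  FlatAtZero.of_le fun N hN => abs_heatRem_le ha N hN

/-- The remainder does not decay at infinity; polynomial growth suffices because it is always
multiplied by rapidly decaying traces. -/
theorem heatRem_isBigO_atTop {a : ℝ} (ha : 0 < a) :
    heatRem a =O[atTop] fun t : ℝ => t ^ (1 / 2 : ℝ) := by
  obtain ⟨C, hC⟩ := abs_heatRem_le ha 1 le_rfl
  refine IsBigO.of_bound C ?_
  filter_upwards [eventually_gt_atTop 0] with t ht
  rw [Real.norm_of_nonneg (Real.rpow_nonneg ht.le _)]
  have h := hC t ht
  rwa [show ((1 : ℕ) : ℝ) + -(1 / 2) = 1 / 2 by norm_num] at h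

/-- The true order is `t^(-1/2)`; the cruder exponent is enough, since the other factor is always
flat at `0`. -/
theorem heatTr_isBigO_zero {a : ℝ} (ha : 0 < a) :
    heatTr a =O[𝓝[>] 0] fun t : ℝ => t ^ (-1 : ℝ) := by
  obtain ⟨C, -, hC⟩ := exists_expSqSum_le 1 le_rfl
  have := Real.pi_pos
  refine IsBigO.of_bound (C / ((Real.pi / a) ^ 2)) ?_
  filter_upwards [self_mem_nhdsWithin] with t ht
  have ht : 0 < t := ht
  rw [Real.norm_of_nonneg (Real.rpow_nonneg ht.le _), Real.norm_of_nonneg (heatTr_nonneg a t),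
    Real.rpow_neg_one]
  refine (hC ((Real.pi / a) ^ 2 * t) (by positivity)).trans (le_of_eq ?_)
  rw [pow_one]
  field_simp

/-! ### Mellin transforms of functions with a power expansion at `0` -/

theorem HasMellin.congr_Ioi {f g : ℝ → ℂ} {s m : ℂ} (h : HasMellin f s m)
    (hfg : ∀ t, 0 < t → f t = g t) : HasMellin g s m := by
  have h1 : ∀ t ∈ Ioi (0 : ℝ), (t : ℂ) ^ (s - 1) • f t = (t : ℂ) ^ (s - 1) • g t :=
    fun t ht => by rw [hfg t ht]
  refine ⟨(integrableOn_congr_fun h1 measurableSet_Ioi).1 h.1, ?_⟩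
  rw [← h.2, mellin, mellin, setIntegral_congr_fun measurableSet_Ioi h1]

theorem HasMellin.add' {f g : ℝ → ℂ} {s m n : ℂ} (hf : HasMellin f s m) (hg : HasMellin g s n) :
    HasMellin (fun t => f t + g t) s (m + n) := by
  have := hasMellin_add hf.1 hg.1
  rwa [hf.2, hg.2] at this

theorem HasMellin.const_mul {f : ℝ → ℂ} {s m : ℂ} (hf : HasMellin f s m) (c : ℂ) :
    HasMellin (fun t => c * f t) s (c * m) := by
  have := hasMellin_const_smul hf.1 c
  rwa [hf.2] at this

theorem HasMellin.cpow_mul {f : ℝ → ℂ} {s m a : ℂ} (hf : HasMellin f (s + a) m) :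
    HasMellin (fun t => (t : ℂ) ^ a * f t) s m :=
  ⟨MellinConvergent.cpow_smul.2 hf.1, by
    rw [← hf.2]; exact mellin_cpow_smul f s a⟩

theorem HasMellin.sum {ι : Type*} (I : Finset ι) {f : ι → ℝ → ℂ} {s : ℂ} {m : ι → ℂ}
    (h : ∀ i ∈ I, HasMellin (f i) s (m i)) :
    HasMellin (fun t => ∑ i ∈ I, f i t) s (∑ i ∈ I, m i) := by
  classical
  induction I using Finset.induction_on with
  | empty =>
    simp only [Finset.sum_empty]
    exact ⟨by simp [MellinConvergent], by simp [mellin]⟩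
  | insert i I hi ih =>
    simp only [Finset.sum_insert hi]
    exact (h i (Finset.mem_insert_self i I)).add'
      (ih fun j hj => h j (Finset.mem_insert_of_mem hj))

theorem mellin_ofReal (f : ℝ → ℝ) (σ : ℝ) :
    mellin (fun t => (f t : ℂ)) σ = ((∫ t in Ioi (0 : ℝ), t ^ (σ - 1) * f t : ℝ) : ℂ) := by
  rw [mellin, ← integral_complex_ofReal]
  refine setIntegral_congr_fun measurableSet_Ioi fun t ht => ?_
  have ht : 0 < t := ht
  simp only [smul_eq_mul]
  push_cast
  rw [Complex.ofReal_cpow ht.le]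
  push_cast
  rfl

/-- The powers are subtracted on `(0, 1]` only. What is left is flat at `0` and rapid at infinity,
so its Mellin transform `G` is entire, and each truncated power contributes `1 / (s + a i)`. Reality
of `G` on the real axis is recorded because the energy has to be a real number. -/
theorem exists_mellin_continuation {ι : Type*} (I : Finset ι) (c a : ι → ℝ) {f : ℝ → ℝ}
    (hf : ContinuousOn f (Ioi 0)) (hinf : RapidAtTop f)
    (h0 : FlatAtZero fun t => f t - ∑ i ∈ I, c i * t ^ a i) :
    ∃ G : ℂ → ℂ, Differentiable ℂ G ∧ (∀ σ : ℝ, ∃ r : ℝ, G σ = r) ∧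
      ∀ s : ℂ, (∀ i ∈ I, 0 < s.re + a i) →
        HasMellin (fun t => (f t : ℂ)) s (G s + ∑ i ∈ I, (c i : ℂ) * (1 / (s + a i))) := by
  set p : ℝ → ℝ := fun t => ∑ i ∈ I, c i * t ^ a i with hp
  set g : ℝ → ℝ := fun t => f t - (Ioc 0 1).indicator p t with hg
  have hpc : ContinuousOn p (Ioi 0) := by
    refine continuousOn_finsetSum _ fun i _ => continuousOn_const.mul ?_
    exact fun t ht => (Real.continuousAt_rpow_const _ _ (Or.inl (ne_of_gt ht))).continuousWithinAt
  have hloc : LocallyIntegrableOn (fun t => (g t : ℂ)) (Ioi 0) := by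
    rw [locallyIntegrableOn_iff isOpen_Ioi.isLocallyClosed]
    intro k hk hkc
    refine Integrable.ofReal ?_
    exact ((hf.mono hk).integrableOn_compact hkc).sub
      (((hpc.mono hk).integrableOn_compact hkc).indicator measurableSet_Ioc)
  have htop : ∀ M : ℝ, (fun t => (g t : ℂ)) =O[atTop] fun t : ℝ => t ^ (-M) := by
    intro M
    rw [← isBigO_norm_left]
    simp only [Complex.norm_real]
    rw [isBigO_norm_left]
    refine (hinf M).congr' ?_ EventuallyEq.rfl
    filter_upwards [eventually_gt_atTop 1] with t ht
    rw [hg]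
    simp [ht]
  have hzero : ∀ M : ℝ, (fun t => (g t : ℂ)) =O[𝓝[>] 0] fun t : ℝ => t ^ (-M) := by
    intro M
    rw [← isBigO_norm_left]
    simp only [Complex.norm_real]
    rw [isBigO_norm_left]
    refine (h0 (-M)).congr' ?_ EventuallyEq.rfl
    filter_upwards [Ioo_mem_nhdsGT one_pos] with t ht
    rw [hg]
    simp [ht.1, ht.2.le, hp]
  refine ⟨mellin fun t => (g t : ℂ), fun s => ?_, fun σ => ⟨_, mellin_ofReal g σ⟩,
    fun s hs => ?_⟩
  · exact mellin_differentiableAt_of_isBigO_rpow hloc (htop (s.re + 1)) (by linarith)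
      (hzero (s.re - 1)) (by linarith)
  · have h1 : HasMellin (fun t => (g t : ℂ)) s (mellin (fun t => (g t : ℂ)) s) :=
      ⟨mellinConvergent_of_isBigO_rpow hloc (htop (s.re + 1)) (by linarith)
        (hzero (s.re - 1)) (by linarith), rfl⟩
    have h2 := HasMellin.sum I (f := fun i t => (c i : ℂ) *
        (Ioc 0 1).indicator (fun t : ℝ => (t : ℂ) ^ (a i : ℂ)) t)
      fun i hi => (hasMellin_cpow_Ioc (a i : ℂ) (s := s) (by simpa using hs i hi)).const_mul (c i)
    refine (h1.add' h2).congr_Ioi fun t ht => ?_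
    by_cases ht1 : t ≤ 1
    · simp only [hg, hp, indicator_of_mem (show t ∈ Ioc (0 : ℝ) 1 from ⟨ht, ht1⟩)]
      push_cast
      rw [sub_add_eq_add_sub, add_sub_assoc, add_eq_left, sub_eq_zero]
      exact Finset.sum_congr rfl fun i _ => by rw [Complex.ofReal_cpow ht.le]
    · have : t ∉ Ioc (0 : ℝ) 1 := fun h => ht1 h.2
      simp [hg, indicator_of_notMem this]

/-! ### The lattice sums of `K₁` -/

theorem crossMu_pos {L₂ L₃ : ℝ} (h₂ : 0 < L₂) (m n : ℕ+) : 0 < crossMu L₂ L₃ m n := by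
  have : 0 < (m : ℝ) := by exact_mod_cast m.pos
  have := Real.pi_pos
  unfold crossMu
  positivity

theorem crossMu_sq (L₂ L₃ : ℝ) (m n : ℕ+) :
    crossMu L₂ L₃ m n ^ 2 = (Real.pi * m / L₂) ^ 2 + (Real.pi * n / L₃) ^ 2 :=
  Real.sq_sqrt (by positivity)

theorem summable_pnat_triple : Summable fun l : ℕ+ × ℕ+ × ℕ+ =>
    ((l.1 : ℝ) ^ 2)⁻¹ * (((l.2.1 : ℝ) ^ 2)⁻¹ * ((l.2.2 : ℝ) ^ 2)⁻¹) := by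
  have h := summable_pnat_pow_inv le_rfl
  exact h.mul_of_nonneg (h.mul_of_nonneg h (fun _ => by positivity) fun _ => by positivity)
    (fun _ => by positivity) fun _ => by positivity

/-- By the arithmetic–geometric inequality `crossMu²` dominates `m n / (L₂ L₃)`, and `crossMu⁴` its
square. The exponents `6` and `4` are those left when `besselInt 0` and `besselInt 1` are bounded
with decay of order `5` and `6`, so this one series majorizes both lattice sums. -/
theorem summable_crossMu {L₂ L₃ : ℝ} (h₂ : 0 < L₂) (h₃ : 0 < L₃) :
    Summable fun l : ℕ+ × ℕ+ × ℕ+ => ((l.1 : ℝ) ^ 6 * crossMu L₂ L₃ l.2.1 l.2.2 ^ 4)⁻¹ := by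
  refine Summable.of_nonneg_of_le (fun _ => by positivity) (fun l => ?_)
    (summable_pnat_triple.mul_left ((L₂ * L₃) ^ 2))
  have hpi := Real.pi_gt_three
  have hn : 1 ≤ (l.1 : ℝ) := by exact_mod_cast l.1.pos
  have hm : 0 < (l.2.1 : ℝ) := by exact_mod_cast l.2.1.pos
  have hk : 0 < (l.2.2 : ℝ) := by exact_mod_cast l.2.2.pos
  have h1 : (l.2.1 : ℝ) * l.2.2 / (L₂ * L₃) ≤ crossMu L₂ L₃ l.2.1 l.2.2 ^ 2 := by
    rw [crossMu_sq]
    have e1 : (Real.pi * l.2.1 / L₂) ^ 2 = Real.pi ^ 2 * ((l.2.1 : ℝ) / L₂) ^ 2 := by ring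
    have e2 : (Real.pi * l.2.2 / L₃) ^ 2 = Real.pi ^ 2 * ((l.2.2 : ℝ) / L₃) ^ 2 := by ring
    have e3 : (l.2.1 : ℝ) * l.2.2 / (L₂ * L₃) = (l.2.1 : ℝ) / L₂ * (l.2.2 / L₃) := by field_simp
    rw [e1, e2, e3]
    have hpi2 : 1 ≤ Real.pi ^ 2 := by nlinarith
    have e4 := le_mul_of_one_le_left (sq_nonneg ((l.2.1 : ℝ) / L₂)) hpi2
    have e5 := le_mul_of_one_le_left (sq_nonneg ((l.2.2 : ℝ) / L₃)) hpi2
    nlinarith [sq_nonneg ((l.2.1 : ℝ) / L₂ - l.2.2 / L₃), sq_nonneg ((l.2.1 : ℝ) / L₂),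
      sq_nonneg ((l.2.2 : ℝ) / L₃), sq_nonneg ((l.2.1 : ℝ) / L₂ + l.2.2 / L₃)]
  have h2 : ((l.2.1 : ℝ) * l.2.2 / (L₂ * L₃)) ^ 2 ≤ crossMu L₂ L₃ l.2.1 l.2.2 ^ 4 := by
    calc _ ≤ (crossMu L₂ L₃ l.2.1 l.2.2 ^ 2) ^ 2 := by gcongr
      _ = _ := by ring
  calc _ ≤ ((l.1 : ℝ) ^ 2 * ((l.2.1 : ℝ) * l.2.2 / (L₂ * L₃)) ^ 2)⁻¹ := by
        gcongr
        · norm_num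
    _ = _ := by field_simp

/-- The lattice sum of `K₁` in the Casimir energy of a box with variable edge `x`. -/
noncomputable def besselSum (L₂ L₃ x : ℝ) : ℝ :=
  ∑' l : ℕ+ × ℕ+ × ℕ+, |crossMu L₂ L₃ l.2.1 l.2.2 / (l.1 : ℝ)| *
    besselK 1 (2 * x * l.1 * crossMu L₂ L₃ l.2.1 l.2.2)

/-- Minus twice the derivative of `besselSum`. -/
noncomputable def besselSumDeriv (L₂ L₃ x : ℝ) : ℝ :=
  ∑' l : ℕ+ × ℕ+ × ℕ+, crossMu L₂ L₃ l.2.1 l.2.2 ^ 2 *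
    besselInt 1 (2 * x * l.1 * crossMu L₂ L₃ l.2.1 l.2.2)

theorem argument_pos {L₂ L₃ : ℝ} (h₂ : 0 < L₂) (l : ℕ+ × ℕ+ × ℕ+) {x : ℝ} (hx : 0 < x) :
    0 < 2 * x * l.1 * crossMu L₂ L₃ l.2.1 l.2.2 := by
  have := crossMu_pos (L₃ := L₃) h₂ l.2.1 l.2.2
  have : 0 < (l.1 : ℝ) := by exact_mod_cast l.1.pos
  positivity

theorem summable_besselInt_zero {L₂ L₃ : ℝ} (h₂ : 0 < L₂) (h₃ : 0 < L₃)
    {x : ℝ} (hx : 0 < x) :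
    Summable fun l : ℕ+ × ℕ+ × ℕ+ => crossMu L₂ L₃ l.2.1 l.2.2 / (l.1 * x) *
      besselInt 0 (2 * (l.1 * x) * crossMu L₂ L₃ l.2.1 l.2.2) := by
  -- Order `5` turns `μ/(n x) · (n x μ)^(-5)` into a multiple of `(n⁶ μ⁴)⁻¹`.
  obtain ⟨C, hC0, hC⟩ := exists_besselInt_le 0 5 (by norm_num)
  refine Summable.of_nonneg_of_le (fun l => ?_) (fun l => ?_)
    ((summable_crossMu h₂ h₃).mul_left (C / (32 * x ^ 6)))
  all_goals
    have hm := crossMu_pos (L₃ := L₃) h₂ l.2.1 l.2.2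
    have hn : 0 < (l.1 : ℝ) := by exact_mod_cast l.1.pos
  · have := besselInt_pos 0 (z := 2 * (l.1 * x) * crossMu L₂ L₃ l.2.1 l.2.2) (by positivity)
    positivity
  · have h := hC (2 * (l.1 * x) * crossMu L₂ L₃ l.2.1 l.2.2) (by positivity)
    calc _ ≤ crossMu L₂ L₃ l.2.1 l.2.2 / (l.1 * x) *
          (C / (2 * (l.1 * x) * crossMu L₂ L₃ l.2.1 l.2.2) ^ 5) := by gcongr
      _ = _ := by field_simp; norm_num

theorem besselSum_eq {L₂ L₃ : ℝ} (h₂ : 0 < L₂) (h₃ : 0 < L₃)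
    {x : ℝ} (hx : 0 < x) :
    HasSum (fun l : ℕ+ × ℕ+ × ℕ+ => crossMu L₂ L₃ l.2.1 l.2.2 / (l.1 * x) *
      besselInt 0 (2 * (l.1 * x) * crossMu L₂ L₃ l.2.1 l.2.2)) (2 / x * besselSum L₂ L₃ x) ∧
    Summable (fun l : ℕ+ × ℕ+ × ℕ+ => |crossMu L₂ L₃ l.2.1 l.2.2 / (l.1 : ℝ)| *
    besselK 1 (2 * x * l.1 * crossMu L₂ L₃ l.2.1 l.2.2)) := by
  have hs := summable_besselInt_zero h₂ h₃ hx
  have heq : ∀ l : ℕ+ × ℕ+ × ℕ+, |crossMu L₂ L₃ l.2.1 l.2.2 / (l.1 : ℝ)| *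
      besselK 1 (2 * x * l.1 * crossMu L₂ L₃ l.2.1 l.2.2) =
      x / 2 * (crossMu L₂ L₃ l.2.1 l.2.2 / (l.1 * x) *
      besselInt 0 (2 * (l.1 * x) * crossMu L₂ L₃ l.2.1 l.2.2)) := by
    intro l
    have hm := crossMu_pos (L₃ := L₃) h₂ l.2.1 l.2.2
    have hn : 0 < (l.1 : ℝ) := by exact_mod_cast l.1.pos
    rw [besselK_one_eq (argument_pos h₂ l hx), abs_of_pos (by positivity),
      show 2 * x * l.1 * crossMu L₂ L₃ l.2.1 l.2.2 =
        2 * (l.1 * x) * crossMu L₂ L₃ l.2.1 l.2.2 by ring]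
    field_simp
  constructor
  · unfold besselSum
    rw [tsum_congr heq, tsum_mul_left, ← mul_assoc, show 2 / x * (x / 2) = 1 by field_simp,
      one_mul]
    exact hs.hasSum
  · exact (hs.mul_left (x / 2)).congr fun l => (heq l).symm

theorem summable_besselInt_one {L₂ L₃ : ℝ} (h₂ : 0 < L₂) (h₃ : 0 < L₃)
    {x : ℝ} (hx : 0 < x) :
    Summable fun l : ℕ+ × ℕ+ × ℕ+ => crossMu L₂ L₃ l.2.1 l.2.2 ^ 2 *
      besselInt 1 (2 * x * l.1 * crossMu L₂ L₃ l.2.1 l.2.2) := by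
  obtain ⟨C, hC0, hC⟩ := exists_besselInt_le 1 6 (by norm_num)
  refine Summable.of_nonneg_of_le (fun l => ?_) (fun l => ?_)
    ((summable_crossMu h₂ h₃).mul_left (C / (64 * x ^ 6)))
  all_goals
    have hm := crossMu_pos (L₃ := L₃) h₂ l.2.1 l.2.2
    have hn : 0 < (l.1 : ℝ) := by exact_mod_cast l.1.pos
  · have := besselInt_pos 1 (argument_pos (L₃ := L₃) h₂ l hx)
    positivity
  · have h := hC _ (argument_pos (L₃ := L₃) h₂ l hx)
    calc _ ≤ crossMu L₂ L₃ l.2.1 l.2.2 ^ 2 *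
          (C / (2 * x * l.1 * crossMu L₂ L₃ l.2.1 l.2.2) ^ 6) := by gcongr
      _ = _ := by field_simp; norm_num

theorem hasDerivAt_besselSum_term {L₂ L₃ : ℝ} (h₂ : 0 < L₂) (l : ℕ+ × ℕ+ × ℕ+) {x : ℝ} (hx : 0 < x) :
    HasDerivAt (fun x : ℝ => besselK 1 (2 * x * l.1 * crossMu L₂ L₃ l.2.1 l.2.2))
      (-(1 / 2) * (l.1 * crossMu L₂ L₃ l.2.1 l.2.2 *
        besselInt 1 (2 * x * l.1 * crossMu L₂ L₃ l.2.1 l.2.2))) x := by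
  have h1 : HasDerivAt (fun x : ℝ => 2 * x * l.1 * crossMu L₂ L₃ l.2.1 l.2.2)
      (2 * l.1 * crossMu L₂ L₃ l.2.1 l.2.2) x := by
    simpa using (((hasDerivAt_id x).const_mul 2).mul_const (l.1 : ℝ)).mul_const
      (crossMu L₂ L₃ l.2.1 l.2.2)
  refine ((hasDerivAt_besselK_one (argument_pos h₂ l hx)).comp x h1).congr_deriv ?_
  ring

theorem abs_mul_besselSum_term {L₂ L₃ : ℝ} (h₂ : 0 < L₂) (l : ℕ+ × ℕ+ × ℕ+) (b : ℝ) :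
    |crossMu L₂ L₃ l.2.1 l.2.2 / (l.1 : ℝ)| * (l.1 * crossMu L₂ L₃ l.2.1 l.2.2 * b) =
      crossMu L₂ L₃ l.2.1 l.2.2 ^ 2 * b := by
  have hm := crossMu_pos (L₃ := L₃) h₂ l.2.1 l.2.2
  have hn : 0 < (l.1 : ℝ) := by exact_mod_cast l.1.pos
  rw [abs_of_pos (by positivity)]
  field_simp

theorem hasDerivAt_besselSum {L₂ L₃ : ℝ} (h₂ : 0 < L₂) (h₃ : 0 < L₃)
    {x : ℝ} (hx : 0 < x) :
    HasDerivAt (besselSum L₂ L₃) (-(1 / 2) * besselSumDeriv L₂ L₃ x) x := by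
  have key := hasDerivAt_tsum_of_isPreconnected
    (g := fun (l : ℕ+ × ℕ+ × ℕ+) (x : ℝ) => |crossMu L₂ L₃ l.2.1 l.2.2 / (l.1 : ℝ)| *
      besselK 1 (2 * x * l.1 * crossMu L₂ L₃ l.2.1 l.2.2))
    (g' := fun (l : ℕ+ × ℕ+ × ℕ+) (x : ℝ) => -(1 / 2) * (crossMu L₂ L₃ l.2.1 l.2.2 ^ 2 *
        besselInt 1 (2 * x * l.1 * crossMu L₂ L₃ l.2.1 l.2.2)))
    -- `besselInt 1` is decreasing, so on `(x/2, ∞)` each term is dominated by its value at `x/2`.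
    (u := fun (l : ℕ+ × ℕ+ × ℕ+) => 1 / 2 * (crossMu L₂ L₃ l.2.1 l.2.2 ^ 2 *
        besselInt 1 (2 * (x / 2) * l.1 * crossMu L₂ L₃ l.2.1 l.2.2)))
    (t := Ioi (x / 2)) (y₀ := x) (y := x)
    ((summable_besselInt_one h₂ h₃ (by positivity)).mul_left _) isOpen_Ioi isPreconnected_Ioi
    (fun l y hy => ?_) (fun l y hy => ?_) (mem_Ioi.2 (by linarith)) (besselSum_eq h₂ h₃ hx).2
    (mem_Ioi.2 (by linarith))
  · rwa [tsum_mul_left] at key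
  · have hy : 0 < y := by have : x / 2 < y := hy; linarith
    refine ((hasDerivAt_besselSum_term h₂ l hy).const_mul _).congr_deriv ?_
    rw [mul_left_comm, abs_mul_besselSum_term h₂]
  · have hy' : x / 2 < y := hy
    have hy0 : 0 < y := by linarith
    have hm := crossMu_pos (L₃ := L₃) h₂ l.2.1 l.2.2
    have hn : 0 < (l.1 : ℝ) := by exact_mod_cast l.1.pos
    have hb := besselInt_pos 1 (argument_pos (L₃ := L₃) h₂ l hy0)
    rw [norm_mul, norm_neg, Real.norm_of_nonneg (by norm_num), Real.norm_of_nonneg (by positivity)]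
    have := (strictAntiOn_besselInt 1).antitoneOn
      (argument_pos (L₃ := L₃) h₂ l (x := x / 2) (by positivity))
      (argument_pos (L₃ := L₃) h₂ l hy0) (by gcongr)
    gcongr

theorem strictAntiOn_besselSumDeriv {L₂ L₃ : ℝ} (h₂ : 0 < L₂) (h₃ : 0 < L₃)
    : StrictAntiOn (besselSumDeriv L₂ L₃) (Ioi 0) := by
  intro a ha b hb hab
  have ha : 0 < a := ha
  have hb : 0 < b := hb
  have h : ∀ l : ℕ+ × ℕ+ × ℕ+, crossMu L₂ L₃ l.2.1 l.2.2 ^ 2 *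
      besselInt 1 (2 * b * l.1 * crossMu L₂ L₃ l.2.1 l.2.2) <
      crossMu L₂ L₃ l.2.1 l.2.2 ^ 2 *
      besselInt 1 (2 * a * l.1 * crossMu L₂ L₃ l.2.1 l.2.2) := by
    intro l
    have hm := crossMu_pos (L₃ := L₃) h₂ l.2.1 l.2.2
    have hn : 0 < (l.1 : ℝ) := by exact_mod_cast l.1.pos
    have := strictAntiOn_besselInt 1 (argument_pos (L₃ := L₃) h₂ l ha)
      (argument_pos (L₃ := L₃) h₂ l hb) (by gcongr)
    gcongr
  exact Summable.tsum_lt_tsum (i := (1, 1, 1)) (fun l => (h l).le) (h _)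
    (summable_besselInt_one h₂ h₃ hb) (summable_besselInt_one h₂ h₃ ha)

/-! ### The spectral zeta function of a box -/

/-- The Dirichlet eigenvalues of a box with edges `a, b, c`. -/
noncomputable def boxEig (a b c : ℝ) (l : ℕ+ × ℕ+ × ℕ+) : ℝ :=
  (Real.pi * l.1 / a) ^ 2 + ((Real.pi * l.2.1 / b) ^ 2 + (Real.pi * l.2.2 / c) ^ 2)

theorem interval_eig_pos {a : ℝ} (ha : 0 < a) (n : ℕ+) : 0 < (Real.pi * n / a) ^ 2 := by
  have := Real.pi_pos
  have : 0 < (n : ℝ) := by exact_mod_cast n.pos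
  positivity

theorem boxEig_pos {a b c : ℝ} (ha : 0 < a) (l : ℕ+ × ℕ+ × ℕ+) : 0 < boxEig a b c l := by
  have := interval_eig_pos ha l.1
  unfold boxEig
  positivity

theorem hasSum_heatTr {a t : ℝ} (ha : 0 < a) (ht : 0 < t) :
    HasSum (fun n : ℕ+ => Real.exp (-(Real.pi * n / a) ^ 2 * t)) (heatTr a t) := by
  have := Real.pi_pos
  refine (summable_exp_sq (y := (Real.pi / a) ^ 2 * t) (by positivity)).hasSum.congr_fun
    fun n => ?_
  congr 1
  ring

theorem hasSum_heatTr_mul {b c t : ℝ} (hb : 0 < b) (hc : 0 < c) (ht : 0 < t) :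
    HasSum (fun l : ℕ+ × ℕ+ =>
      Real.exp (-((Real.pi * l.1 / b) ^ 2 + (Real.pi * l.2 / c) ^ 2) * t))
      (heatTr b t * heatTr c t) := by
  have h₂ := hasSum_heatTr hb ht
  have h₃ := hasSum_heatTr hc ht
  have := h₂.mul h₃ (h₂.summable.mul_of_nonneg h₃.summable (fun _ => (Real.exp_pos _).le)
    fun _ => (Real.exp_pos _).le)
  refine this.congr_fun fun l => ?_
  rw [← Real.exp_add]
  congr 1
  ring

theorem hasSum_heatTr_box {a b c t : ℝ} (ha : 0 < a) (hb : 0 < b) (hc : 0 < c) (ht : 0 < t) :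
    HasSum (fun l : ℕ+ × ℕ+ × ℕ+ => Real.exp (-boxEig a b c l * t))
      (heatTr a t * (heatTr b t * heatTr c t)) := by
  have h₂ := hasSum_heatTr ha ht
  have h₃ := hasSum_heatTr_mul hb hc ht
  have := h₂.mul h₃ (h₂.summable.mul_of_nonneg h₃.summable (fun _ => (Real.exp_pos _).le)
    fun _ => (Real.exp_pos _).le)
  refine this.congr_fun fun l => ?_
  rw [← Real.exp_add, boxEig]
  congr 1
  ring

/-- The box eigenvalue is at least each of its three summands, so its power `σ` is at least the
product of their powers `σ/3`, and the sum factorizes. The threshold `3` is not sharp, but any right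
half-plane will do. -/
theorem summable_boxEig_rpow {a b c σ : ℝ} (ha : 0 < a) (hb : 0 < b) (hc : 0 < c) (hσ : 3 ≤ σ) :
    Summable fun l : ℕ+ × ℕ+ × ℕ+ => (boxEig a b c l ^ σ)⁻¹ := by
  have h1 : ∀ a : ℝ, 0 < a → Summable fun n : ℕ+ => (((Real.pi * n / a) ^ 2) ^ (σ / 3))⁻¹ := by
    intro a ha
    have hs : Summable fun n : ℕ+ => ((n : ℝ) ^ (2 * (σ / 3)))⁻¹ :=
      (Real.summable_nat_rpow_inv.2 (by linarith)).comp_injective PNat.coe_injective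
    refine (hs.mul_left (((Real.pi / a) ^ 2) ^ (σ / 3))⁻¹).congr fun n => ?_
    rw [← mul_inv, Real.rpow_mul (by positivity), ← Real.mul_rpow (by positivity) (by positivity),
      Real.rpow_two]
    congr 2
    ring
  refine Summable.of_nonneg_of_le
    (fun l => inv_nonneg.2 (Real.rpow_nonneg (boxEig_pos ha l).le _)) (fun l => ?_)
    ((h1 a ha).mul_of_nonneg ((h1 b hb).mul_of_nonneg (h1 c hc) (fun _ => by positivity)
      fun _ => by positivity) (fun _ => by positivity) fun _ => by positivity)
  have p1 := interval_eig_pos ha l.1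
  have p2 := interval_eig_pos hb l.2.1
  have p3 := interval_eig_pos hc l.2.2
  rw [← mul_inv, ← mul_inv]
  refine inv_anti₀ (by positivity) ?_
  have hE := boxEig_pos (b := b) (c := c) ha l
  have : boxEig a b c l ^ σ = boxEig a b c l ^ (σ / 3) *
      (boxEig a b c l ^ (σ / 3) * boxEig a b c l ^ (σ / 3)) := by
    rw [← Real.rpow_add hE, ← Real.rpow_add hE]
    congr 1
    ring
  rw [this]
  gcongr <;> (unfold boxEig; linarith)

/-- The Mellin transform of the flat part at `s = -1/2`. The factors `t^(-3/2)` and `t^(-1/2)`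
combine to `t^(-2)`, and expanding all three theta sums gives positive terms that
`besselInt_scaling` integrates to `K₁` values; their summability justifies the interchange. -/
theorem integral_heatRem_mul_heatTr {a b c : ℝ} (ha : 0 < a) (hb : 0 < b) (hc : 0 < c) :
    ∫ t in Ioi (0 : ℝ), t ^ ((-(1 / 2) : ℝ) - 1) *
      (heatRem a t * (heatTr b t * heatTr c t)) = 2 / √Real.pi * besselSum b c a := by
  have hpi := Real.pi_pos
  set F : ℕ+ × ℕ+ × ℕ+ → ℝ → ℝ := fun l t =>
    (t ^ 2)⁻¹ * Real.exp (-((l.1 * a) ^ 2 / t) - crossMu b c l.2.1 l.2.2 ^ 2 * t) with hF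
  have hn : ∀ l : ℕ+ × ℕ+ × ℕ+, 0 < (l.1 : ℝ) * a := fun l => by
    have : 0 < (l.1 : ℝ) := by exact_mod_cast l.1.pos
    positivity
  have hsc := fun l : ℕ+ × ℕ+ × ℕ+ => besselInt_scaling (hn l)
    (crossMu_pos (L₃ := c) hb l.2.1 l.2.2)
  have h := hasSum_integral_of_summable_integral_norm (μ := volume.restrict (Ioi (0 : ℝ)))
    (F := F) (fun l => (hsc l).1) (by
      refine (summable_besselInt_zero hb hc ha).congr fun l => ?_
      rw [← (hsc l).2]
      refine setIntegral_congr_fun measurableSet_Ioi fun t ht => ?_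
      exact (Real.norm_of_nonneg (by positivity)).symm)
  have h2 := h.unique ((besselSum_eq hb hc ha).1.congr_fun (fun l => (hsc l).2))
  have h3 : ∀ t ∈ Ioi (0 : ℝ), t ^ ((-(1 / 2) : ℝ) - 1) *
      (heatRem a t * (heatTr b t * heatTr c t)) = a / √Real.pi * ∑' l, F l t := by
    intro t ht
    have ht : 0 < t := ht
    have s1 : HasSum (fun n : ℕ+ => Real.exp (-((n : ℝ) ^ 2 * (a ^ 2 / t))))
      (expSqSum (a ^ 2 / t)) := (summable_exp_sq (by positivity)).hasSum
    have s2 := hasSum_heatTr_mul hb hc ht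
    have s3 := (s1.mul s2 (s1.summable.mul_of_nonneg s2.summable (fun _ => (Real.exp_pos _).le)
      fun _ => (Real.exp_pos _).le)).mul_left (t ^ 2)⁻¹
    have s4 : HasSum (fun l => F l t) ((t ^ 2)⁻¹ * (expSqSum (a ^ 2 / t) *
        (heatTr b t * heatTr c t))) := by
      refine s3.congr_fun fun l => ?_
      rw [hF, ← Real.exp_add]
      simp only [crossMu_sq]
      congr 2
      field_simp
      ring
    rw [s4.tsum_eq, heatRem]
    have : t ^ ((-(1 / 2) : ℝ) - 1) * t ^ (-(1 / 2) : ℝ) = (t ^ 2)⁻¹ := by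
      rw [← Real.rpow_add ht, ← Real.rpow_two, ← Real.rpow_neg ht.le]
      norm_num
    rw [← this]
    ring
  rw [setIntegral_congr_fun measurableSet_Ioi h3, integral_const_mul, h2]
  field_simp

theorem heatTr_mul_expansion {b c : ℝ} (hb : 0 < b) (hc : 0 < c) :
    FlatAtZero fun t => heatTr b t * heatTr c t - ∑ i : Fin 3,
      (![b / √Real.pi / 2 * (c / √Real.pi / 2), -(1 / 2) * (b / √Real.pi / 2 + c / √Real.pi / 2),
        1 / 4] : Fin 3 → ℝ) i * t ^ (![-1, -(1 / 2), 0] : Fin 3 → ℝ) i := by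
  have hp : ∀ a : ℝ, (fun t : ℝ => a / √Real.pi / 2 * t ^ (-(1 / 2) : ℝ) - 1 / 2)
      =O[𝓝[>] 0] fun t : ℝ => t ^ (-(1 / 2) : ℝ) := by
    intro a
    refine ((isBigO_refl _ _).const_mul_left _).sub ?_
    refine IsBigO.trans (IsBigO.const_mul_left ?_ (1 / 2) : (fun t : ℝ => (1 / 2 : ℝ) * t ^ (0 : ℝ))
      =O[𝓝[>] 0] fun t : ℝ => t ^ (-(1 / 2) : ℝ)) (isBigO_refl _ _) |>.congr_left (by simp)
    exact isBigO_rpow_rpow_zero (by norm_num)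
  -- With each trace split as `P + R`, the error in the product is `R_b P_c + R_c (P_b + R_b)`, and
  -- both summands have a flat factor.
  have h1 := (flatAtZero_heatRem hb).mul_isBigO (hp c)
  have h2 := (flatAtZero_heatRem hc).mul_isBigO (heatTr_isBigO_zero hb)
  refine (h1.add h2).congr fun t ht => ?_
  have e : t ^ (-1 : ℝ) = t ^ (-(1 / 2) : ℝ) * t ^ (-(1 / 2) : ℝ) := by
    rw [← Real.rpow_add ht]; norm_num
  simp only [Fin.sum_univ_three, Matrix.cons_val_zero, Matrix.cons_val_one, Matrix.cons_val,
    Real.rpow_zero, e]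
  rw [heatTr_eq hb ht, heatTr_eq hc ht]
  ring

/-- The quantifier order is the point: `α` and `β` come from the cross-section alone and serve every
edge `a`, so the part of the energy outside the Bessel sum is affine in `a`. -/
theorem exists_zeta_box {b c : ℝ} (hb : 0 < b) (hc : 0 < c) :
    ∃ α β : ℝ, ∀ a : ℝ, 0 < a → ∃ Z : ℂ → ℂ, Meromorphic Z ∧
      (∀ s : ℂ, 3 < s.re → HasSum (fun l => (boxEig a b c l : ℂ) ^ (-s)) (Z s)) ∧
      Tendsto Z (𝓝[≠] (-1 / 2))
        (𝓝 (2 * ((α * a + β - 1 / (2 * Real.pi) * besselSum b c a : ℝ) : ℂ))) := by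
  set H : ℝ → ℝ := fun t => heatTr b t * heatTr c t with hH
  have hHc : ContinuousOn H (Ioi 0) := (continuousOn_heatTr hb).mul (continuousOn_heatTr hc)
  have hHr : RapidAtTop H := (rapidAtTop_heatTr hb).mul_isBigO (rapidAtTop_heatTr hc 0)
  obtain ⟨G, hG, hGr, hGm⟩ := exists_mellin_continuation Finset.univ _ _ hHc hHr
    (heatTr_mul_expansion hb hc)
  set C : Fin 3 → ℝ := ![b / √Real.pi / 2 * (c / √Real.pi / 2),
    -(1 / 2) * (b / √Real.pi / 2 + c / √Real.pi / 2), 1 / 4] with hC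
  set e : Fin 3 → ℝ := ![-1, -(1 / 2), 0] with he
  set ξ : ℂ → ℂ := fun s => G s + ∑ i, (C i : ℂ) * (1 / (s + e i)) with hξ
  have hξm : Meromorphic ξ := by
    intro s
    refine (hG.analyticAt s).meromorphicAt.add ?_
    simp only [Fin.sum_univ_three]
    fun_prop
  have hξr : ∀ σ : ℝ, ∃ r : ℝ, ξ σ = r := by
    intro σ
    obtain ⟨r, hr⟩ := hGr σ
    refine ⟨r + ∑ i, C i * (1 / (σ + e i)), ?_⟩
    rw [hξ]
    simp only [hr]
    push_cast
    rfl
  -- The possible poles of `ξ` are at `1`, `1/2` and `0`, whereas only its values at `-1` and `-1/2`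
  -- enter.
  have hξc : ∀ σ : ℝ, σ < 0 → ContinuousAt ξ σ := by
    intro σ hσ
    refine hG.continuous.continuousAt.add ?_
    refine tendsto_finsetSum _ fun i _ => ?_
    refine (continuousAt_const (y := (C i : ℂ))).mul (ContinuousAt.div continuousAt_const
      (by fun_prop) ?_)
    have : σ + e i ≠ 0 := by
      refine ne_of_lt (add_neg_of_neg_of_nonpos hσ ?_)
      fin_cases i <;> simp [he]
    exact_mod_cast this
  obtain ⟨r1, hr1⟩ := hξr (-1)
  obtain ⟨r2, hr2⟩ := hξr (-(1 / 2))
  have hpi := Real.pi_pos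
  have hΓ : Complex.Gamma (-1 / 2) = -2 * (√Real.pi : ℂ) := by
    have h := Complex.Gamma_add_one (-1 / 2) (by norm_num)
    rw [show (-1 / 2 : ℂ) + 1 = 1 / 2 by norm_num, Complex.Gamma_one_half_eq] at h
    have h2 : (Real.pi : ℂ) ^ (1 / 2 : ℂ) = (√Real.pi : ℂ) := by
      rw [Real.sqrt_eq_rpow, Complex.ofReal_cpow hpi.le]
      norm_num
    rw [← h2, h]
    ring
  -- Here `1 / (2 Γ(-1/2)) = -1/(4√π)` multiplies `ξ(-1)/(2√π)`, the coefficient of `a`, and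
  -- `-ξ(-1/2)/2`.
  refine ⟨-(1 / (4 * √Real.pi)) * (1 / √Real.pi / 2 * r1), 1 / (8 * √Real.pi) * r2,
    fun a ha => ?_⟩
  have hBc : ContinuousOn (fun t => heatRem a t * H t) (Ioi 0) :=
    (continuousOn_heatRem ha).mul hHc
  have hBr : RapidAtTop fun t => heatRem a t * H t := fun M =>
    (hHr.mul_isBigO (heatRem_isBigO_atTop ha) M).congr_left fun t => mul_comm _ _
  have hBf : FlatAtZero fun t => heatRem a t * H t := by
    refine (flatAtZero_heatRem ha).mul_isBigO (b := -1 + -1) ?_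
    exact isBigO_rpow_mul_zero (heatTr_isBigO_zero hb) (heatTr_isBigO_zero hc)
  -- With no powers to subtract, the Mellin integral of the flat part converges at every `s`; in
  -- particular `B (-1/2)` is an honest integral.
  obtain ⟨B, hB, -, hBm⟩ := exists_mellin_continuation (∅ : Finset ℕ) 0 0 hBc hBr
    (hBf.congr fun t _ => by simp)
  simp only [Finset.sum_empty, add_zero, Finset.notMem_empty, false_imp_iff, implies_true,
    forall_const] at hBm
  set A : ℂ := ((a / √Real.pi / 2 : ℝ) : ℂ) with hA
  set Z : ℂ → ℂ := fun s =>
    (Complex.Gamma s)⁻¹ * (A * ξ (s + -(1 / 2)) + -(1 / 2) * ξ s + B s) with hZ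
  have hZt : Tendsto Z (𝓝 (-1 / 2)) (𝓝 (Z (-1 / 2))) := by
    have c1 : ContinuousAt ξ (-1 / 2 : ℂ) := by
      have := hξc (-(1 / 2)) (by norm_num)
      convert this using 1; push_cast; ring
    have c2 : ContinuousAt ξ (-1 / 2 + -(1 / 2) : ℂ) := by
      have := hξc (-1) (by norm_num)
      convert this using 1; push_cast; ring
    have c3 : ContinuousAt (fun s : ℂ => ξ (s + -(1 / 2))) (-1 / 2 : ℂ) :=
      ContinuousAt.comp (f := fun s : ℂ => s + -(1 / 2)) c2 (by fun_prop)
    exact (Complex.differentiable_one_div_Gamma.continuous.continuousAt).mul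
      (((continuousAt_const.mul c3).add (continuousAt_const.mul c1)).add hB.continuous.continuousAt)
  refine ⟨Z, ?_, ?_, ?_⟩
  · intro s
    have m1 : MeromorphicAt (fun s : ℂ => ξ (s + -(1 / 2))) s := by
      refine (((hG.comp (differentiable_id.add_const (-(1 / 2)))).analyticAt s).meromorphicAt).add ?_
      simp only [Fin.sum_univ_three]
      fun_prop
    exact (Complex.differentiable_one_div_Gamma.analyticAt s).meromorphicAt.mul
      ((((MeromorphicAt.const _ _).mul m1).add ((MeromorphicAt.const _ _).mul (hξm s))).add
        (hB.analyticAt s).meromorphicAt)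
  · intro s hs
    have hei : ∀ i, -1 ≤ e i := by intro i; fin_cases i <;> norm_num [he]
    have k1 : HasMellin (fun t => (t : ℂ) ^ (-(1 / 2) : ℂ) * (H t : ℂ)) s (ξ (s + -(1 / 2))) := by
      refine HasMellin.cpow_mul (hGm _ fun i _ => ?_)
      have := hei i
      norm_num
      linarith
    have k2 : HasMellin (fun t => (H t : ℂ)) s (ξ s) := hGm _ fun i _ => by
      have := hei i
      linarith
    have k := ((k1.const_mul A).add' (k2.const_mul (-(1 / 2)))).add' (hBm s)
    have k' : HasMellin (fun t => ((heatTr a t * H t : ℝ) : ℂ)) s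
        (A * ξ (s + -(1 / 2)) + -(1 / 2) * ξ s + B s) := by
      refine k.congr_Ioi fun t ht => ?_
      have : (t : ℂ) ^ (-(1 / 2) : ℂ) = ((t ^ (-(1 / 2) : ℝ) : ℝ) : ℂ) := by
        rw [Complex.ofReal_cpow ht.le]; push_cast; rfl
      rw [this, heatTr_eq ha ht, hA]
      push_cast
      ring
    have hsum := hasSum_mellin (a := fun _ => 1) (p := boxEig a b c) (s := s)
      (F := fun t => ((heatTr a t * H t : ℝ) : ℂ)) (fun l => Or.inr (boxEig_pos ha l))
      (by linarith) (fun t ht => by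
        simp only [one_mul]
        exact_mod_cast hasSum_heatTr_box ha hb hc ht)
      ((summable_boxEig_rpow ha hb hc hs.le).congr fun l => by simp)
    rw [k'.2] at hsum
    have hΓ0 : Complex.Gamma s ≠ 0 := Complex.Gamma_ne_zero_of_re_pos (by linarith)
    refine (hsum.mul_left (Complex.Gamma s)⁻¹).congr_fun fun l => ?_
    rw [Complex.cpow_neg]
    field_simp
  · have hval : Z (-1 / 2) =
        2 * ((-(1 / (4 * √Real.pi)) * (1 / √Real.pi / 2 * r1) * a + 1 / (8 * √Real.pi) * r2 -
          1 / (2 * Real.pi) * besselSum b c a : ℝ) : ℂ) := by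
      have hBv : B (-1 / 2) = ((2 / √Real.pi * besselSum b c a : ℝ) : ℂ) := by
        rw [← (hBm (-1 / 2)).2, ← integral_heatRem_mul_heatTr ha hb hc, ← mellin_ofReal]
        congr 1
        push_cast
        ring
      have v1 : ξ (-1 / 2 + -(1 / 2)) = r1 := by rw [← hr1]; congr 1; push_cast; ring
      have v2 : ξ (-1 / 2) = r2 := by rw [← hr2]; congr 1; push_cast; ring
      have hsq : (√Real.pi : ℂ) ≠ 0 := by exact_mod_cast (Real.sqrt_pos.2 hpi).ne'
      have hsq2 : (Real.pi : ℂ) = (√Real.pi : ℂ) ^ 2 := by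
        exact_mod_cast (Real.sq_sqrt hpi.le).symm
      rw [hZ]
      simp only [hBv, v1, v2, hΓ, hA]
      push_cast
      rw [hsq2]
      field_simp
      ring
    rw [← hval]
    exact hZt.mono_left nhdsWithin_le_nhds

/-! ### Uniqueness of heat coefficients and of meromorphic continuations -/

/-- Once the earlier coefficients agree, subtracting the two expansions shows that a constant is
`O(t^(1/2))`, hence zero. -/
theorem IsHeatExpansion.unique {d : ℕ} {lam a a' : ℕ → ℝ} (h : IsHeatExpansion d lam a)
    (h' : IsHeatExpansion d lam a') : a = a' := by
  funext m
  induction m using Nat.strong_induction_on with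
  | _ m ih =>
    have h1 := (h.2 (m + 1)).sub (h'.2 (m + 1))
    have h2 : (fun t : ℝ => (a' m - a m) * t ^ (((m : ℝ) - d) / 2)) =O[𝓝[>] 0]
        fun t : ℝ => t ^ ((((m + 1 : ℕ) : ℝ) - d) / 2) := by
      refine h1.congr_left fun t => ?_
      rw [Finset.sum_range_succ, Finset.sum_range_succ,
        Finset.sum_congr rfl fun n hn => by rw [ih n (Finset.mem_range.1 hn)]]
      ring
    have h3 := isBigO_rpow_mul_zero h2 (isBigO_refl (fun t : ℝ => t ^ (-(((m : ℝ) - d) / 2))) _)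
    have h4 : (fun _ : ℝ => a' m - a m) =O[𝓝[>] 0] fun t : ℝ => t ^ (1 / 2 : ℝ) := by
      refine h3.congr' ?_ ?_
      · filter_upwards [self_mem_nhdsWithin] with t ht
        rw [mul_assoc, ← Real.rpow_add ht, add_neg_cancel, Real.rpow_zero, mul_one]
      · refine Eventually.of_forall fun t => ?_
        exact congr_arg (fun z : ℝ => t ^ z) (by push_cast; ring)
    have h5 : Tendsto (fun t : ℝ => t ^ (1 / 2 : ℝ)) (𝓝[>] 0) (𝓝 0) := by
      have := (Real.continuousAt_rpow_const 0 (1 / 2) (Or.inr (by norm_num))).tendsto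
      rw [Real.zero_rpow (by norm_num)] at this
      exact this.mono_left nhdsWithin_le_nhds
    have h6 := tendsto_nhds_unique tendsto_const_nhds (h4.trans_tendsto h5)
    linarith

/-- The identity theorem for meromorphic functions: infinite order of the difference at one point
spreads over the connected plane. Only punctured neighbourhoods can be compared, because values at
poles are arbitrary. -/
theorem Meromorphic.eventuallyEq_of_eq_halfPlane {Z W : ℂ → ℂ} (hZ : Meromorphic Z)
    (hW : Meromorphic W) {σ : ℝ} (h : ∀ s : ℂ, σ < s.re → Z s = W s) (s₀ : ℂ) :
    Z =ᶠ[𝓝[≠] s₀] W := by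
  have hD : MeromorphicOn (Z - W) univ := fun s _ => (hZ s).sub (hW s)
  have h1 : meromorphicOrderAt (Z - W) ((σ + 1 : ℝ) : ℂ) = ⊤ := by
    rw [meromorphicOrderAt_eq_top_iff]
    have : {s : ℂ | σ < s.re} ∈ 𝓝 ((σ + 1 : ℝ) : ℂ) :=
      (isOpen_lt continuous_const Complex.continuous_re).mem_nhds (by simp)
    filter_upwards [mem_nhdsWithin_of_mem_nhds this] with s hs
    rw [Pi.sub_apply, h s hs, sub_self]
  have h2 : meromorphicOrderAt (Z - W) s₀ = ⊤ := by
    by_contra hne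
    exact ((hD.exists_meromorphicOrderAt_ne_top_iff_forall isConnected_univ).1
      ⟨⟨s₀, mem_univ _⟩, hne⟩ ⟨_, mem_univ _⟩) h1
  rw [meromorphicOrderAt_eq_top_iff] at h2
  filter_upwards [h2] with s hs using sub_eq_zero.1 hs

theorem IsZetaContinuation.eventuallyEq {lam : ℕ → ℝ} {Z W : ℂ → ℂ}
    (hZ : IsZetaContinuation lam Z) (hW : IsZetaContinuation lam W) (s₀ : ℂ) :
    Z =ᶠ[𝓝[≠] s₀] W := by
  obtain ⟨hZm, σ, hσ⟩ := hZ
  obtain ⟨hWm, τ, hτ⟩ := hW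
  exact hZm.eventuallyEq_of_eq_halfPlane hWm (σ := max σ τ) (fun s hs =>
    (hσ s (lt_of_le_of_lt (le_max_left _ _) hs)).unique
      (hτ s (lt_of_le_of_lt (le_max_right _ _) hs))) s₀

/-- If the function has a finite limit, so does `R / (s - s₀)`, and multiplying by `s - s₀` forces
`R = 0`. -/
theorem HasResidueFinitePart.eq_of_tendsto {Z : ℂ → ℂ} {s₀ R FP z : ℂ}
    (h : HasResidueFinitePart Z s₀ R FP) (hz : Tendsto Z (𝓝[≠] s₀) (𝓝 z)) : FP = z := by
  have h1 : Tendsto (fun s => R / (s - s₀)) (𝓝[≠] s₀) (𝓝 (z - FP)) :=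
    (hz.sub h).congr fun s => by ring
  have h2 : Tendsto (fun s : ℂ => s - s₀) (𝓝[≠] s₀) (𝓝 0) := by
    have : Tendsto (fun s : ℂ => s - s₀) (𝓝 s₀) (𝓝 (s₀ - s₀)) :=
      (continuous_id.sub continuous_const).tendsto s₀
    rw [sub_self] at this
    exact this.mono_left nhdsWithin_le_nhds
  have h3 : Tendsto (fun _ : ℂ => R) (𝓝[≠] s₀) (𝓝 ((z - FP) * 0)) := by
    refine (h1.mul h2).congr' ?_
    filter_upwards [self_mem_nhdsWithin] with s hs
    exact div_mul_cancel₀ R (sub_ne_zero.2 hs)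
  have hR : R = 0 := by simpa using tendsto_nhds_unique tendsto_const_nhds h3
  have h4 : Tendsto Z (𝓝[≠] s₀) (𝓝 FP) := h.congr fun s => by simp [hR]
  exact tendsto_nhds_unique h4 hz

/-! ### The heat expansion of a box -/

/-- The heat kernel coefficients of a box. -/
noncomputable def boxHeatCoeff (a b c : ℝ) (n : ℕ) : ℝ :=
  let A := a / √Real.pi / 2
  let B := b / √Real.pi / 2
  let C := c / √Real.pi / 2
  if n = 0 then A * B * C else if n = 1 then -(1 / 2) * (A * B + A * C + B * C)
  else if n = 2 then 1 / 4 * (A + B + C) else if n = 3 then -(1 / 8) else 0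

theorem flatAtZero_heatTr_box {a b c : ℝ} (ha : 0 < a) (hb : 0 < b) (hc : 0 < c) :
    FlatAtZero fun t => heatTr a t * (heatTr b t * heatTr c t) -
      ∑ n ∈ Finset.range 4, boxHeatCoeff a b c n * t ^ (((n : ℝ) - (3 : ℕ)) / 2) := by
  have hp : (fun t : ℝ => a / √Real.pi / 2 * t ^ (-(1 / 2) : ℝ) - 1 / 2)
      =O[𝓝[>] 0] fun t : ℝ => t ^ (-(1 / 2) : ℝ) := by
    refine ((isBigO_refl _ _).const_mul_left _).sub ?_
    refine (IsBigO.const_mul_left (isBigO_rpow_rpow_zero (a := -(1 / 2)) (b := 0) (by norm_num))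
      (1 / 2)).congr_left (by simp)
  have h1 := (flatAtZero_heatRem ha).mul_isBigO
    (isBigO_rpow_mul_zero (heatTr_isBigO_zero hb) (heatTr_isBigO_zero hc))
  have h2 := (heatTr_mul_expansion hb hc).mul_isBigO hp
  refine (h1.add h2).congr fun t ht => ?_
  set u := t ^ (-(1 / 2) : ℝ) with hu
  have e1 : t ^ (-1 : ℝ) = u * u := by
    rw [hu, ← Real.rpow_add ht]; norm_num
  have f0 : t ^ ((((0 : ℕ) : ℝ) - (3 : ℕ)) / 2) = u * u * u := by
    rw [hu, ← Real.rpow_add ht, ← Real.rpow_add ht]; norm_num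
  have f1 : t ^ ((((1 : ℕ) : ℝ) - (3 : ℕ)) / 2) = u * u := by
    rw [hu, ← Real.rpow_add ht]; norm_num
  have f2 : t ^ ((((2 : ℕ) : ℝ) - (3 : ℕ)) / 2) = u := by
    rw [hu]; norm_num
  have f3 : t ^ ((((3 : ℕ) : ℝ) - (3 : ℕ)) / 2) = 1 := by
    norm_num
  simp only [Fin.sum_univ_three, Matrix.cons_val_zero, Matrix.cons_val_one, Matrix.cons_val,
    Finset.sum_range_succ, Finset.sum_range_zero, Real.rpow_zero, e1, f0, f1, f2, f3]
  simp only [boxHeatCoeff]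
  norm_num
  rw [heatTr_eq ha ht, ← hu]
  ring

theorem isHeatExpansion_box {a b c : ℝ} (ha : 0 < a) (hb : 0 < b) (hc : 0 < c) {lam : ℕ → ℝ}
    (e : ℕ ≃ ℕ+ × ℕ+ × ℕ+) (he : ∀ j, lam j = boxEig a b c (e j)) :
    IsHeatExpansion 3 lam (boxHeatCoeff a b c) := by
  have hsum : ∀ t : ℝ, 0 < t → HasSum (fun j => Real.exp (-lam j * t))
      (heatTr a t * (heatTr b t * heatTr c t)) := by
    intro t ht
    refine (e.hasSum_iff.2 (hasSum_heatTr_box ha hb hc ht)).congr_fun fun j => ?_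
    rw [he]
    rfl
  refine ⟨fun t ht => (hsum t ht).summable, fun N => ?_⟩
  -- Truncating at `N + 4` always includes the four nonzero coefficients; the terms with indices `N`
  -- to `N + 3` are then absorbed into the error of order `N`.
  have h0 : ∀ t : ℝ, ∑ n ∈ Finset.range (N + 4), boxHeatCoeff a b c n *
      t ^ (((n : ℝ) - (3 : ℕ)) / 2) =
      ∑ n ∈ Finset.range 4, boxHeatCoeff a b c n * t ^ (((n : ℝ) - (3 : ℕ)) / 2) := by
    intro t
    rw [add_comm, Finset.sum_range_add]
    refine add_eq_left.2 (Finset.sum_eq_zero fun i _ => ?_)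
    have : boxHeatCoeff a b c (4 + i) = 0 := by
      simp only [boxHeatCoeff]
      rw [if_neg (by omega), if_neg (by omega), if_neg (by omega), if_neg (by omega)]
    rw [this, zero_mul]
  have h1 : (fun t : ℝ => ∑ x ∈ Finset.range 4, boxHeatCoeff a b c (N + x) *
      t ^ ((((N + x : ℕ) : ℝ) - (3 : ℕ)) / 2)) =O[𝓝[>] 0]
      fun t : ℝ => t ^ (((N : ℝ) - (3 : ℕ)) / 2) := by
    refine IsBigO.fun_sum fun x _ => ((isBigO_rpow_rpow_zero ?_).const_mul_left _)
    push_cast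
    have : (0 : ℝ) ≤ x := Nat.cast_nonneg x
    linarith
  refine ((flatAtZero_heatTr_box ha hb hc _).add h1).congr' ?_ EventuallyEq.rfl
  filter_upwards [self_mem_nhdsWithin] with t ht
  rw [(hsum t ht).tsum_eq, ← h0, Finset.sum_range_add]
  ring

/-! ### Products of sines on a box -/

/-- The function `sin(k π (y - a) / (b - a))`. -/
noncomputable def sinFn (a b : ℝ) (k : ℕ) (y : ℝ) : ℝ := Real.sin (k * (Real.pi * (y - a) / (b - a)))

theorem integral_cos_int {a b : ℝ} (hab : a < b) {j : ℤ} (hj : j ≠ 0) :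
    ∫ y in a..b, Real.cos (j * (Real.pi * (y - a) / (b - a))) = 0 := by
  have hpi := Real.pi_pos
  have hw : b - a ≠ 0 := (sub_pos.2 hab).ne'
  have hj' : (j : ℝ) ≠ 0 := by exact_mod_cast hj
  have hd : ∀ y ∈ uIcc a b, HasDerivAt
      (fun y => (b - a) / (j * Real.pi) * Real.sin (j * (Real.pi * (y - a) / (b - a))))
      (Real.cos (j * (Real.pi * (y - a) / (b - a)))) y := by
    intro y _
    have h1 : HasDerivAt (fun y : ℝ => (j : ℝ) * (Real.pi * (y - a) / (b - a)))
        (j * (Real.pi * 1 / (b - a))) y :=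
      ((((hasDerivAt_id y).sub_const a).const_mul Real.pi).div_const (b - a)).const_mul (j : ℝ)
    refine (h1.sin.const_mul ((b - a) / (j * Real.pi))).congr_deriv ?_
    field_simp
  rw [intervalIntegral.integral_eq_sub_of_hasDerivAt hd
    (by apply Continuous.intervalIntegrable; fun_prop)]
  have : Real.pi * (b - a) / (b - a) = Real.pi := by field_simp
  rw [this, Real.sin_int_mul_pi]
  simp

theorem integral_sinFn_mul {a b : ℝ} (hab : a < b) {k m : ℕ} (hk : 0 < k) (hm : 0 < m) :
    ∫ y in Icc a b, sinFn a b k y * sinFn a b m y = if k = m then (b - a) / 2 else 0 := by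
  rw [integral_Icc_eq_integral_Ioc, ← intervalIntegral.integral_of_le hab.le]
  have h : ∀ y, sinFn a b k y * sinFn a b m y =
      1 / 2 * Real.cos (((k - m : ℤ) : ℝ) * (Real.pi * (y - a) / (b - a))) -
      1 / 2 * Real.cos (((k + m : ℤ) : ℝ) * (Real.pi * (y - a) / (b - a))) := by
    intro y
    unfold sinFn
    push_cast
    rw [sub_mul, add_mul, Real.cos_sub, Real.cos_add]
    ring
  simp_rw [h]
  rw [intervalIntegral.integral_sub (by apply Continuous.intervalIntegrable; fun_prop)
    (by apply Continuous.intervalIntegrable; fun_prop), intervalIntegral.integral_const_mul,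
    intervalIntegral.integral_const_mul, integral_cos_int hab (j := (k + m : ℤ)) (by omega)]
  split_ifs with hkm
  · subst hkm
    simp
    ring
  · rw [integral_cos_int hab (by omega)]
    simp

section
variable {d : ℕ} (lo hi : Fin d → ℝ)

/-- The product of the functions `sin(k_i π (y_i - lo_i) / (hi_i - lo_i))`. -/
noncomputable def sinProd (k : Fin d → ℕ) (y : Fin d → ℝ) : ℝ := ∏ i, sinFn (lo i) (hi i) (k i) (y i)

theorem continuous_sinFn (a b : ℝ) (k : ℕ) : Continuous (sinFn a b k) := by
  unfold sinFn; fun_prop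

theorem continuous_sinProd (k : Fin d → ℕ) : Continuous (sinProd lo hi k) :=
  continuous_finsetProd _ fun i _ => (continuous_sinFn _ _ _).comp (continuous_apply i)

theorem integral_sinProd_mul {lo hi : Fin d → ℝ} (h : ∀ i, lo i < hi i) (k m : Fin d → ℕ+) :
    ∫ y in Icc lo hi, sinProd lo hi (fun i => k i) y * sinProd lo hi (fun i => m i) y =
      if k = m then ∏ i, (hi i - lo i) / 2 else 0 := by
  rw [← pi_univ_Icc, volume_pi, Measure.restrict_pi_pi]
  simp_rw [sinProd, ← Finset.prod_mul_distrib]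
  rw [integral_fintype_prod_eq_prod (𝕜 := ℝ) (fun i y => sinFn (lo i) (hi i) (k i) y *
    sinFn (lo i) (hi i) (m i) y)]
  simp_rw [integral_sinFn_mul (h _) (k _).pos (m _).pos]
  split_ifs with hkm
  · subst hkm
    simp
  · obtain ⟨i, hi⟩ := Function.ne_iff.1 hkm
    exact Finset.prod_eq_zero (Finset.mem_univ i) (if_neg fun h => hi (PNat.coe_injective h))

/-- `cos(π (y_i - lo_i) / (hi_i - lo_i))` as a continuous function. -/
noncomputable def cosMap (i : Fin d) : C(Fin d → ℝ, ℝ) :=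
  ⟨fun y => Real.cos (Real.pi * (y i - lo i) / (hi i - lo i)), by fun_prop⟩

/-- `sinProd` as a continuous function. -/
noncomputable def sinProdMap (k : Fin d → ℕ) : C(Fin d → ℝ, ℝ) :=
  ⟨sinProd lo hi k, continuous_sinProd lo hi k⟩

theorem sinProd_update (k : Fin d → ℕ) (i : Fin d) (m : ℕ) (y : Fin d → ℝ) :
    sinProd lo hi (Function.update k i m) y = sinFn (lo i) (hi i) m (y i) *
      ∏ j ∈ Finset.univ.erase i, sinFn (lo j) (hi j) (k j) (y j) := by
  rw [sinProd, ← Finset.mul_prod_erase Finset.univ _ (Finset.mem_univ i), Function.update_self]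
  congr 1
  exact Finset.prod_congr rfl fun j hj => by
    rw [Function.update_of_ne (Finset.ne_of_mem_erase hj)]

theorem sinProd_eq_zero {k : Fin d → ℕ} {i : Fin d} (hk : k i = 0) (y : Fin d → ℝ) :
    sinProd lo hi k y = 0 :=
  Finset.prod_eq_zero (Finset.mem_univ i) (by simp [sinFn, hk])

/-- Product-to-sum makes the span of the sine products a module over the cosine polynomials. Zero
frequencies are admitted in the span, so `k i = 1` needs no separate treatment; `k i = 0` does, as
`k i - 1` is truncated. -/
theorem sinProdMap_mul_cosMap (k : Fin d → ℕ) (i : Fin d) :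
    sinProdMap lo hi k * cosMap lo hi i ∈ Submodule.span ℝ (range (sinProdMap lo hi)) := by
  rcases Nat.eq_zero_or_pos (k i) with hk | hk
  · have : sinProdMap lo hi k = 0 := by
      ext y; exact sinProd_eq_zero lo hi hk y
    rw [this, zero_mul]
    exact zero_mem _
  · have : sinProdMap lo hi k * cosMap lo hi i = (1 / 2 : ℝ) •
        (sinProdMap lo hi (Function.update k i (k i + 1)) +
          sinProdMap lo hi (Function.update k i (k i - 1))) := by
      ext y
      change sinProd lo hi k y * Real.cos _ = (1 / 2 : ℝ) *
        (sinProd lo hi (Function.update k i (k i + 1)) y +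
          sinProd lo hi (Function.update k i (k i - 1)) y)
      have h1 := sinProd_update lo hi k i (k i) y
      rw [Function.update_eq_self] at h1
      rw [sinProd_update, sinProd_update, h1, sinFn, sinFn, sinFn, Nat.cast_sub hk]
      push_cast
      rw [add_mul, sub_mul, one_mul, Real.sin_add, Real.sin_sub]
      ring
    rw [this]
    exact Submodule.smul_mem _ _ (add_mem (Submodule.subset_span ⟨_, rfl⟩)
      (Submodule.subset_span ⟨_, rfl⟩))

theorem mul_mem_span_sinProdMap {g w : C(Fin d → ℝ, ℝ)}
    (hg : g ∈ Algebra.adjoin ℝ (range (cosMap lo hi)))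
    (hw : w ∈ Submodule.span ℝ (range (sinProdMap lo hi))) :
    w * g ∈ Submodule.span ℝ (range (sinProdMap lo hi)) := by
  induction hg using Algebra.adjoin_induction generalizing w with
  | mem x hx =>
    obtain ⟨i, rfl⟩ := hx
    induction hw using Submodule.span_induction with
    | mem y hy => obtain ⟨k, rfl⟩ := hy; exact sinProdMap_mul_cosMap lo hi k i
    | zero => rw [zero_mul]; exact zero_mem _
    | add y z _ _ hy hz => rw [add_mul]; exact add_mem hy hz
    | smul r y _ hy => rw [smul_mul_assoc]; exact Submodule.smul_mem _ r hy
  | algebraMap r =>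
    rw [mul_comm, ← Algebra.smul_def]
    exact Submodule.smul_mem _ r hw
  | add x y _ _ hx hy => rw [mul_add]; exact add_mem (hx hw) (hy hw)
  | mul x y _ _ hx hy => rw [← mul_assoc]; exact hy (hx hw)

/-- The sine products are complete in the continuous functions on a box. -/
theorem eq_zero_of_integral_sinProd_eq_zero {lo hi : Fin d → ℝ} (h : ∀ i, lo i < hi i)
    {u : (Fin d → ℝ) → ℝ} (hu : Continuous u)
    (h0 : ∀ k : Fin d → ℕ+, ∫ y in Icc lo hi, u y * sinProd lo hi (fun i => k i) y = 0)
    {y : Fin d → ℝ} (hy : ∀ i, y i ∈ Ioo (lo i) (hi i)) : u y = 0 := by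
  have hpi := Real.pi_pos
  have hint : ∀ f : (Fin d → ℝ) → ℝ, Continuous f → IntegrableOn f (Icc lo hi) :=
    fun f hf => hf.continuousOn.integrableOn_compact isCompact_Icc
  have hspan : ∀ w ∈ Submodule.span ℝ (range (sinProdMap lo hi)),
      ∫ y in Icc lo hi, u y * w y = 0 := by
    intro w hw
    induction hw using Submodule.span_induction with
    | mem w hw =>
      obtain ⟨k, rfl⟩ := hw
      change ∫ y in Icc lo hi, u y * sinProd lo hi k y = 0
      by_cases hk : ∀ i, 0 < k i
      · exact h0 fun i => ⟨k i, hk i⟩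
      · push Not at hk
        obtain ⟨i, hi0⟩ := hk
        simp [sinProd_eq_zero lo hi (Nat.le_zero.1 hi0)]
    | zero => simp
    | add w z _ _ hw hz =>
      simp only [ContinuousMap.add_apply, mul_add]
      rw [integral_add (hint (fun y => u y * w y) (hu.mul w.continuous))
        (hint (fun y => u y * z y) (hu.mul z.continuous)), hw, hz,
        add_zero]
    | smul r w _ hw =>
      simp only [ContinuousMap.smul_apply, smul_eq_mul, mul_left_comm _ r]
      rw [integral_const_mul, hw, mul_zero]
  -- The lowest sine product has no zero inside the box, so it suffices to show that `u s` vanishes.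
  -- Multiplying by `s` turns cosine polynomials into elements of the sine span.
  set s := sinProd lo hi (fun _ => 1) with hs
  have hsc : Continuous s := continuous_sinProd lo hi _
  set f : (Fin d → ℝ) → ℝ := fun y => u y * s y with hf
  have hfc : Continuous f := hu.mul hsc
  have : CompactSpace (Icc lo hi) := isCompact_iff_compactSpace.1 isCompact_Icc
  set res : C(Fin d → ℝ, ℝ) →ₐ[ℝ] C(Icc lo hi, ℝ) :=
    ContinuousMap.compRightAlgHom ℝ ℝ ⟨Subtype.val, continuous_subtype_val⟩ with hres
  -- The coordinate cosines run over half a period and are injective there, so they separate points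
  -- of the closed box and Stone–Weierstrass applies.
  set A := (Algebra.adjoin ℝ (range (cosMap lo hi))).map res with hA
  have hsep : A.SeparatesPoints := by
    intro x z hxz
    obtain ⟨i, hxi⟩ := Function.ne_iff.1 fun h => hxz (Subtype.ext h)
    refine ⟨_, ⟨res (cosMap lo hi i), ⟨_, Algebra.subset_adjoin ⟨i, rfl⟩, rfl⟩, rfl⟩, ?_⟩
    change Real.cos (Real.pi * (x.1 i - lo i) / (hi i - lo i)) ≠
      Real.cos (Real.pi * (z.1 i - lo i) / (hi i - lo i))
    have hw : 0 < hi i - lo i := sub_pos.2 (h i)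
    have hmem : ∀ x : Icc lo hi, Real.pi * (x.1 i - lo i) / (hi i - lo i) ∈ Icc 0 Real.pi := by
      intro x
      have h1 := x.2.1 i
      have h2 := x.2.2 i
      refine ⟨div_nonneg (mul_nonneg hpi.le (by linarith)) hw.le, ?_⟩
      rw [div_le_iff₀ hw]
      exact mul_le_mul_of_nonneg_left (by linarith) hpi.le
    intro hcos
    have := Real.injOn_cos (hmem x) (hmem z) hcos
    rw [div_left_inj' hw.ne', mul_right_inj' hpi.ne', sub_left_inj] at this
    exact hxi this
  -- If `g` is a cosine polynomial within `ε` of `f = u s`, then `f g = u (s g)` integrates to zero,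
  -- so `∫ f² = ∫ f (f - g)` is at most `ε ∫ |f|`.
  have hle : ∀ ε : ℝ, 0 < ε → ∫ y in Icc lo hi, f y * f y ≤ ε * ∫ y in Icc lo hi, |f y| := by
    intro ε hε
    obtain ⟨⟨_, g, hg, rfl⟩, hgf⟩ :=
      ContinuousMap.exists_mem_subalgebra_near_continuous_of_separatesPoints A hsep
        (fun y : Icc lo hi => f y) (hfc.comp continuous_subtype_val) ε hε
    have hgf' : ∀ y ∈ Icc lo hi, |g y - f y| < ε := fun y hy => hgf ⟨y, hy⟩
    have hz : ∫ y in Icc lo hi, f y * g y = 0 := by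
      have := hspan _ (mul_mem_span_sinProdMap lo hi hg (Submodule.subset_span ⟨fun _ => 1, rfl⟩))
      rw [← this]
      refine integral_congr_ae (Eventually.of_forall fun y => ?_)
      change u y * s y * g y = u y * (s y * g y)
      ring
    have h1 : ∫ y in Icc lo hi, f y * f y = ∫ y in Icc lo hi, (f y * f y - f y * g y) := by
      rw [integral_sub (hint (fun y => f y * f y) (hfc.mul hfc))
        (hint (fun y => f y * g y) (hfc.mul g.continuous)), hz, sub_zero]
    rw [h1, ← integral_const_mul]
    refine setIntegral_mono_on ((hint _ (hfc.mul hfc)).sub (hint _ (hfc.mul g.continuous)))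
      ((hint _ hfc.abs).const_mul ε) measurableSet_Icc fun y hy => ?_
    calc f y * f y - f y * g y ≤ |f y * f y - f y * g y| := le_abs_self _
      _ = |g y - f y| * |f y| := by rw [← abs_mul, abs_sub_comm]; congr 1; ring
      _ ≤ ε * |f y| := by
        have := (hgf' y hy).le
        gcongr
  have hzero : ∫ y in Icc lo hi, f y * f y = 0 := by
    refine le_antisymm ?_ (integral_nonneg fun y => mul_self_nonneg _)
    have ht : Tendsto (fun ε : ℝ => ε * ∫ y in Icc lo hi, |f y|) (𝓝[>] 0)
        (𝓝 (0 * ∫ y in Icc lo hi, |f y|)) :=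
      ((continuous_id.mul continuous_const).tendsto 0).mono_left nhdsWithin_le_nhds
    rw [zero_mul] at ht
    exact ge_of_tendsto ht (by filter_upwards [self_mem_nhdsWithin] with ε hε using hle ε hε)
  have hae : (fun y => f y * f y) =ᵐ[volume.restrict (Icc lo hi)] 0 :=
    (setIntegral_eq_zero_iff_of_nonneg_ae (Eventually.of_forall fun y => mul_self_nonneg _)
      (hint _ (hfc.mul hfc))).1 hzero
  have hsub : (univ.pi fun i => Ioo (lo i) (hi i)) ⊆ Icc lo hi := fun y hy =>
    ⟨fun i => (hy i (mem_univ i)).1.le, fun i => (hy i (mem_univ i)).2.le⟩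
  have heq := Measure.eqOn_open_of_ae_eq (ae_restrict_of_ae_restrict_of_subset hsub hae)
    (isOpen_set_pi finite_univ fun i _ => isOpen_Ioo) (hfc.mul hfc).continuousOn
    continuousOn_const
  have hfy : f y = 0 := mul_self_eq_zero.1 (heq fun i _ => hy i)
  refine (mul_eq_zero.1 hfy).resolve_right (Finset.prod_ne_zero_iff.2 fun i _ => ?_)
  have hw : 0 < hi i - lo i := sub_pos.2 (h i)
  have h1 := sub_pos.2 (hy i).1
  refine (Real.sin_pos_of_pos_of_lt_pi ?_ ?_).ne'
  · rw [Nat.cast_one, one_mul]; positivity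
  · rw [Nat.cast_one, one_mul, div_lt_iff₀ hw]
    exact mul_lt_mul_of_pos_left (by linarith [(hy i).2]) hpi

end

/-! ### Partial derivatives and the Laplacian -/

/-- The `i`-th partial derivative. -/
noncomputable def partialD {d : ℕ} (i : Fin d) (g : (Fin d → ℝ) → ℝ) (y : Fin d → ℝ) : ℝ :=
  fderiv ℝ g y (Pi.single i 1)

/-- Passes from the Euclidean space, where the Laplacian lives, to plain functions on `Fin d`, where
product integrals and the divergence theorem live. -/
theorem laplacian_eq_sum_partialD {d : ℕ} {u : EuclideanSpace ℝ (Fin d) → ℝ}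
    {y : Fin d → ℝ} (hu : ContDiffAt ℝ 2 u (WithLp.toLp 2 y)) :
    (Δ u) (WithLp.toLp 2 y) =
      ∑ i, partialD i (partialD i fun y => u (WithLp.toLp 2 y)) y := by
  set T : (Fin d → ℝ) ≃L[ℝ] EuclideanSpace ℝ (Fin d) :=
    (PiLp.continuousLinearEquiv 2 ℝ fun _ : Fin d => ℝ).symm with hT
  have hTe : ∀ i, T (Pi.single i 1) = EuclideanSpace.single i 1 := fun i => rfl
  have h1 : ∀ i, partialD i (fun y => u (WithLp.toLp 2 y)) =
      (fun z => fderiv ℝ u z (EuclideanSpace.single i 1)) ∘ T := by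
    intro i
    ext y
    change fderiv ℝ (u ∘ T) y (Pi.single i 1) = _
    rw [T.comp_right_fderiv]
    rfl
  have hd : DifferentiableAt ℝ (fderiv ℝ u) (WithLp.toLp 2 y) :=
    (hu.fderiv_right (m := 1) (by norm_num)).differentiableAt (by norm_num)
  rw [InnerProductSpace.laplacian_eq_iteratedFDeriv_orthonormalBasis u
    (EuclideanSpace.basisFun (Fin d) ℝ)]
  refine Finset.sum_congr rfl fun i _ => ?_
  rw [iteratedFDeriv_two_apply, h1, partialD, T.comp_right_fderiv]
  change _ = fderiv ℝ _ (WithLp.toLp 2 y) (EuclideanSpace.single i 1)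
  rw [fderiv_clm_apply hd (differentiableAt_const _)]
  simp [EuclideanSpace.basisFun_apply]

theorem partialD_comp_affine {d : ℕ} (i : Fin d) (g : (Fin d → ℝ) → ℝ) (b : Fin d → ℝ) (r : ℝ) :
    partialD i (fun y => g (r • y + b)) = fun y => r * partialD i g (r • y + b) := by
  ext y
  have h := fderiv_comp_smul (𝕜 := ℝ) (f := fun z => g (z + b)) (x := y) r
  rw [partialD, h, fderiv_comp_add_right]
  rfl

theorem partialD_const_mul {d : ℕ} (i : Fin d) (g : (Fin d → ℝ) → ℝ) (r : ℝ) :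
    partialD i (fun y => r * g y) = fun y => r * partialD i g y := by
  ext y
  have h := congr_fun (fderiv_const_smul_field (𝕜 := ℝ) (f := g) r) y
  rw [partialD, show (fun y => r * g y) = r • g from rfl, h]
  rfl

theorem partialD_prod {d : ℕ} {φ : Fin d → ℝ → ℝ} (hφ : ∀ j, Differentiable ℝ (φ j)) (i : Fin d) :
    partialD i (fun y => ∏ j, φ j (y j)) =
      fun y => ∏ j, Function.update φ i (deriv (φ i)) j (y j) := by
  ext y
  have h : ∀ j ∈ Finset.univ, HasFDerivAt (fun y : Fin d → ℝ => φ j (y j))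
      (deriv (φ j) (y j) • ContinuousLinearMap.proj (R := ℝ) (φ := fun _ : Fin d => ℝ) j) y :=
    fun j _ => (hφ j (y j)).hasDerivAt.comp_hasFDerivAt y
      (ContinuousLinearMap.proj (R := ℝ) (φ := fun _ : Fin d => ℝ) j).hasFDerivAt
  rw [partialD, (HasFDerivAt.finsetProd h).fderiv, sum_apply,
    Finset.sum_eq_single i]
  · rw [← Finset.mul_prod_erase Finset.univ _ (Finset.mem_univ i), Function.update_self]
    simp only [smul_apply, ContinuousLinearMap.proj_apply, Pi.single_eq_same,
      smul_eq_mul, mul_one]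
    rw [mul_comm]
    congr 1
    exact Finset.prod_congr rfl fun j hj => by
      rw [Function.update_of_ne (Finset.ne_of_mem_erase hj)]
  · intro j _ hj
    simp [Pi.single_eq_of_ne hj]
  · simp

theorem contDiff_sinFn (a b : ℝ) (k : ℕ) {n : WithTop ℕ∞} : ContDiff ℝ n (sinFn a b k) := by
  unfold sinFn; fun_prop

theorem hasDerivAt_sinFn (a b : ℝ) (k : ℕ) (y : ℝ) : HasDerivAt (sinFn a b k)
    (Real.pi * k / (b - a) * Real.cos (k * (Real.pi * (y - a) / (b - a)))) y := by
  have h1 : HasDerivAt (fun y : ℝ => (k : ℝ) * (Real.pi * (y - a) / (b - a)))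
      (k * (Real.pi * 1 / (b - a))) y :=
    ((((hasDerivAt_id y).sub_const a).const_mul Real.pi).div_const (b - a)).const_mul (k : ℝ)
  exact h1.sin.congr_deriv (by ring)

theorem deriv_deriv_sinFn (a b : ℝ) (k : ℕ) (y : ℝ) : deriv (deriv (sinFn a b k)) y =
    -(Real.pi * k / (b - a)) ^ 2 * sinFn a b k y := by
  have h0 : deriv (sinFn a b k) = fun y =>
      Real.pi * k / (b - a) * Real.cos (k * (Real.pi * (y - a) / (b - a))) :=
    funext fun y => (hasDerivAt_sinFn a b k y).deriv
  have h1 : HasDerivAt (fun y : ℝ => (k : ℝ) * (Real.pi * (y - a) / (b - a)))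
      (k * (Real.pi * 1 / (b - a))) y :=
    ((((hasDerivAt_id y).sub_const a).const_mul Real.pi).div_const (b - a)).const_mul (k : ℝ)
  rw [h0, (h1.cos.const_mul (Real.pi * k / (b - a))).deriv, sinFn]
  ring

section
variable {d : ℕ} (lo hi : Fin d → ℝ)

theorem contDiff_sinProd (k : Fin d → ℕ) {n : WithTop ℕ∞} : ContDiff ℝ n (sinProd lo hi k) :=
  contDiff_prod fun i _ => (contDiff_sinFn _ _ _).comp (contDiff_apply ℝ ℝ i)

theorem contDiff_partialD_sinProd (k : Fin d → ℕ) (i : Fin d) :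
    ContDiff ℝ 1 (partialD i (sinProd lo hi k)) :=
  ((contDiff_sinProd lo hi k (n := 2)).fderiv_right (by norm_num)).clm_apply contDiff_const

theorem partialD_partialD_sinProd (k : Fin d → ℕ) (i : Fin d) (y : Fin d → ℝ) :
    partialD i (partialD i (sinProd lo hi k)) y =
      -(Real.pi * k i / (hi i - lo i)) ^ 2 * sinProd lo hi k y := by
  have h1 : ∀ j, Differentiable ℝ (sinFn (lo j) (hi j) (k j)) := fun j =>
    (contDiff_sinFn _ _ _ (n := 1)).differentiable (by norm_num)
  have h2 : Differentiable ℝ (deriv (sinFn (lo i) (hi i) (k i))) :=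
    ((contDiff_succ_iff_deriv (n := 1)).1 (contDiff_sinFn (lo i) (hi i) (k i))).2.2.differentiable
      (by norm_num)
  have h3 := partialD_prod h1 i
  have h4 := partialD_prod (φ := Function.update (fun j => sinFn (lo j) (hi j) (k j)) i
    (deriv (sinFn (lo i) (hi i) (k i)))) (fun j => by
      rcases eq_or_ne j i with rfl | hj
      · rwa [Function.update_self]
      · rw [Function.update_of_ne hj]; exact h1 j) i
  change partialD i (partialD i fun y => ∏ j, sinFn (lo j) (hi j) (k j) (y j)) y = _
  rw [h3, h4]
  simp only [Function.update_self, Function.update_idem]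
  rw [sinProd, ← Finset.mul_prod_erase Finset.univ _ (Finset.mem_univ i), Function.update_self,
    deriv_deriv_sinFn, ← Finset.mul_prod_erase Finset.univ _ (Finset.mem_univ i), mul_assoc]
  congr 2
  exact Finset.prod_congr rfl fun j hj => by
    rw [Function.update_of_ne (Finset.ne_of_mem_erase hj)]

/-- The Dirichlet eigenvalues of a box. -/
noncomputable def boxEigenvalue (k : Fin d → ℕ) : ℝ := ∑ i, (Real.pi * k i / (hi i - lo i)) ^ 2

theorem sum_partialD_sinProd (k : Fin d → ℕ) (y : Fin d → ℝ) :
    ∑ i, partialD i (partialD i (sinProd lo hi k)) y =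
      -boxEigenvalue lo hi k * sinProd lo hi k y := by
  simp_rw [partialD_partialD_sinProd, ← Finset.sum_mul, boxEigenvalue, Finset.sum_neg_distrib]

variable {lo hi}

theorem sinProd_eq_zero_of_face (h : ∀ i, lo i < hi i) (k : Fin d → ℕ) {y : Fin d → ℝ} {i : Fin d}
    (hy : y i = lo i ∨ y i = hi i) : sinProd lo hi k y = 0 := by
  refine Finset.prod_eq_zero (Finset.mem_univ i) ?_
  rcases hy with hy | hy
  · simp [sinFn, hy]
  · have hw : hi i - lo i ≠ 0 := (sub_pos.2 (h i)).ne'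
    rw [sinFn, hy, mul_div_assoc, div_self hw, mul_one, Real.sin_nat_mul_pi]

end

/-- The open box with opposite corners `lo` and `hi`. -/
def openBox {d : ℕ} (lo hi : Fin d → ℝ) : Set (EuclideanSpace ℝ (Fin d)) :=
  {x | ∀ i, x i ∈ Ioo (lo i) (hi i)}

/-- A Dirichlet eigenfunction is orthogonal to the sine products with another eigenvalue. -/
theorem integral_eigenfunction_mul_sinProd {n : ℕ} {lo hi : Fin (n + 1) → ℝ}
    (h : ∀ i, lo i < hi i) {c : ℝ} {u : EuclideanSpace ℝ (Fin (n + 1)) → ℝ}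
    (hu : u ∈ dirichletEigenspace (openBox lo hi) c) (k : Fin (n + 1) → ℕ) :
    (c - boxEigenvalue lo hi k) *
      ∫ y in Icc lo hi, u (WithLp.toLp 2 y) * sinProd lo hi k y = 0 := by
  obtain ⟨huc, hu0, hu2⟩ := hu
  set v : (Fin (n + 1) → ℝ) → ℝ := fun y => u (WithLp.toLp 2 y) with hv
  have hvc : Continuous v := huc.comp (PiLp.continuous_toLp 2 _)
  set ψ := sinProd lo hi k with hψ
  have hψd : Differentiable ℝ ψ := (contDiff_sinProd lo hi k (n := 1)).differentiable (by norm_num)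
  have hψ1 : ∀ i, ContDiff ℝ 1 (partialD i ψ) := contDiff_partialD_sinProd lo hi k
  -- The contraction of ratio `r` towards the centre. An eigenfunction is `C²` only in the open box
  -- and its derivatives are not controlled at the boundary, so Green's identity is applied to `v ∘
  -- A r` with `r < 1`, whose eigenvalue is `r² c`.
  set A : ℝ → (Fin (n + 1) → ℝ) → Fin (n + 1) → ℝ :=
    fun r y => r • y + (1 - r) • ((1 / 2 : ℝ) • (lo + hi)) with hA
  have hAc : Continuous fun p : ℝ × (Fin (n + 1) → ℝ) => A p.1 p.2 := by fun_prop
  have hlohi : lo ≤ hi := fun i => (h i).le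
  have hAmem : ∀ r ∈ Ioo (0 : ℝ) 1, ∀ y ∈ Icc lo hi, WithLp.toLp 2 (A r y) ∈ openBox lo hi := by
    intro r hr y hy i
    have h1 := hy.1 i
    have h2 := hy.2 i
    have h3 := h i
    change r * y i + (1 - r) * (1 / 2 * (lo i + hi i)) ∈ Ioo (lo i) (hi i)
    constructor <;> nlinarith [hr.1, hr.2, mul_pos (sub_pos.2 hr.2) (sub_pos.2 h3),
      mul_nonneg hr.1.le (sub_nonneg.2 h1), mul_nonneg hr.1.le (sub_nonneg.2 h2)]
  set J : ℝ → ℝ := fun r => ∫ y in Icc lo hi, v (A r y) * ψ y with hJ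
  set K : ℝ → ℝ := fun r => ∑ i : Fin (n + 1),
    ((∫ x in Icc (lo ∘ i.succAbove) (hi ∘ i.succAbove),
        v (A r (i.insertNth (hi i) x)) * partialD i ψ (i.insertNth (hi i) x)) -
      ∫ x in Icc (lo ∘ i.succAbove) (hi ∘ i.succAbove),
        v (A r (i.insertNth (lo i) x)) * partialD i ψ (i.insertNth (lo i) x)) with hK
  have hJc : Continuous J := by
    refine continuous_parametric_integral_of_continuous ?_ isCompact_Icc
    exact (hvc.comp hAc).mul (hψd.continuous.comp continuous_snd)
  have hKc : Continuous K := by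
    refine continuous_finsetSum _ fun i _ => Continuous.sub ?_ ?_ <;>
    · refine continuous_parametric_integral_of_continuous ?_ isCompact_Icc
      have hins : ∀ b : ℝ, Continuous fun p : ℝ × (Fin n → ℝ) =>
          (i.insertNth b p.2 : Fin (n + 1) → ℝ) := fun b =>
        Continuous.finInsertNth i continuous_const continuous_snd
      exact (hvc.comp (hAc.comp (continuous_fst.prodMk (hins _)))).mul
        ((hψ1 i).continuous.comp (hins _))
  have hgreen : ∀ r ∈ Ioo (0 : ℝ) 1, (r ^ 2 * c - boxEigenvalue lo hi k) * J r = K r := by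
    intro r hr
    set w : (Fin (n + 1) → ℝ) → ℝ := fun y => v (A r y) with hw
    have hwc : Continuous w := hvc.comp (hAc.comp (continuous_const.prodMk continuous_id))
    have hw2 : ∀ y ∈ Icc lo hi, ContDiffAt ℝ 2 w y := by
      intro y hy
      have h1 : ContDiffAt ℝ 2 (fun y => WithLp.toLp 2 (A r y) :
          (Fin (n + 1) → ℝ) → EuclideanSpace ℝ (Fin (n + 1))) y := by
        refine ContDiff.contDiffAt ?_
        exact (PiLp.contDiff_toLp (p := 2)).comp
          ((contDiff_id.const_smul r).add contDiff_const)
      exact (hu2 _ (hAmem r hr y hy)).1.comp y h1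
    have hwd : ∀ y ∈ Icc lo hi, DifferentiableAt ℝ w y := fun y hy =>
      (hw2 y hy).differentiableAt (by norm_num)
    have hwp : ∀ i, ∀ y ∈ Icc lo hi, DifferentiableAt ℝ (partialD i w) y := fun i y hy =>
      (((hw2 y hy).fderiv_right (m := 1) (by norm_num)).differentiableAt (by norm_num)).clm_apply
        (differentiableAt_const _)
    have hlap : ∀ y ∈ Icc lo hi, ∑ i, partialD i (partialD i w) y = -(r ^ 2 * c) * w y := by
      intro y hy
      have h1 := hu2 _ (hAmem r hr y hy)
      have h2 := laplacian_eq_sum_partialD h1.1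
      have h3 : ∀ i, partialD i (partialD i w) y = r * (r * partialD i (partialD i v) (A r y)) := by
        intro i
        rw [show w = fun y => v (r • y + (1 - r) • ((1 / 2 : ℝ) • (lo + hi))) from rfl,
          partialD_comp_affine, partialD_const_mul, partialD_comp_affine]
      simp_rw [h3, ← Finset.mul_sum]
      rw [← h2]
      have h4 := h1.2
      have h5 : w y = u (WithLp.toLp 2 (A r y)) := rfl
      rw [h5]
      linear_combination (-r ^ 2) * h4
    set f : Fin (n + 1) → (Fin (n + 1) → ℝ) → ℝ :=
      fun i y => w y * partialD i ψ y - ψ y * partialD i w y with hf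
    have hfd : ∀ i, ∀ y ∈ Icc lo hi, HasFDerivAt (f i)
        ((w y • fderiv ℝ (partialD i ψ) y + partialD i ψ y • fderiv ℝ w y) -
          (ψ y • fderiv ℝ (partialD i w) y + partialD i w y • fderiv ℝ ψ y)) y := fun i y hy =>
      ((hwd y hy).hasFDerivAt.mul
        (((hψ1 i).differentiable (by norm_num)) y).hasFDerivAt).sub
        ((hψd y).hasFDerivAt.mul (hwp i y hy).hasFDerivAt)
    have hdiv : ∀ y ∈ Icc lo hi, ∑ i : Fin (n + 1),
        ((w y • fderiv ℝ (partialD i ψ) y + partialD i ψ y • fderiv ℝ w y) -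
          (ψ y • fderiv ℝ (partialD i w) y + partialD i w y • fderiv ℝ ψ y)) (Pi.single i 1) =
        (r ^ 2 * c - boxEigenvalue lo hi k) * (w y * ψ y) := by
      intro y hy
      have h1 : ∀ i : Fin (n + 1),
          ((w y • fderiv ℝ (partialD i ψ) y + partialD i ψ y • fderiv ℝ w y) -
          (ψ y • fderiv ℝ (partialD i w) y + partialD i w y • fderiv ℝ ψ y)) (Pi.single i 1) =
          w y * partialD i (partialD i ψ) y - ψ y * partialD i (partialD i w) y := by
        intro i
        change (w y * partialD i (partialD i ψ) y + partialD i ψ y * partialD i w y) -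
          (ψ y * partialD i (partialD i w) y + partialD i w y * partialD i ψ y) = _
        ring
      simp_rw [h1]
      rw [Finset.sum_sub_distrib, ← Finset.mul_sum, ← Finset.mul_sum, sum_partialD_sinProd,
        hlap y hy]
      ring
    have hsub : (univ.pi fun i => Ioo (lo i) (hi i)) ⊆ Icc lo hi := fun y hy =>
      ⟨fun i => (hy i (mem_univ i)).1.le, fun i => (hy i (mem_univ i)).2.le⟩
    have hint : IntegrableOn (fun y => (r ^ 2 * c - boxEigenvalue lo hi k) * (w y * ψ y))
        (Icc lo hi) :=
      (continuous_const.mul (hwc.mul hψd.continuous)).continuousOn.integrableOn_compact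
        isCompact_Icc
    have key := integral_divergence_of_hasFDerivAt_off_countable' lo hi hlohi f
      (fun i y => (w y • fderiv ℝ (partialD i ψ) y + partialD i ψ y • fderiv ℝ w y) -
          (ψ y • fderiv ℝ (partialD i w) y + partialD i w y • fderiv ℝ ψ y)) ∅ countable_empty
      (fun i y hy => (hfd i y hy).continuousAt.continuousWithinAt)
      (fun y hy i => hfd i y (hsub hy.1))
      ((integrableOn_congr_fun hdiv measurableSet_Icc).2 hint)
    rw [setIntegral_congr_fun measurableSet_Icc hdiv, integral_const_mul] at key
    rw [hJ, hK]
    refine key.trans (Finset.sum_congr rfl fun i _ => ?_)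
    -- On the faces `ψ = 0` removes the term containing derivatives of `w`. Only values of `v`
    -- remain, and these are continuous up to `r = 1`.
    have hface : ∀ b : ℝ, b = lo i ∨ b = hi i → ∀ x : Fin n → ℝ, f i (i.insertNth b x) =
        v (A r (i.insertNth b x)) * partialD i ψ (i.insertNth b x) := by
      intro b hb x
      have : ψ (i.insertNth b x) = 0 := sinProd_eq_zero_of_face h k (i := i) (by simpa using hb)
      simp only [hf, this, zero_mul, sub_zero, hw]
    simp_rw [hface _ (Or.inl rfl), hface _ (Or.inr rfl)]
  have hone : (1 ^ 2 * c - boxEigenvalue lo hi k) * J 1 = K 1 := by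
    have t1 : Tendsto (fun r : ℝ => (r ^ 2 * c - boxEigenvalue lo hi k) * J r) (𝓝[<] 1)
        (𝓝 ((1 ^ 2 * c - boxEigenvalue lo hi k) * J 1)) :=
      ((by fun_prop : Continuous fun r : ℝ =>
        (r ^ 2 * c - boxEigenvalue lo hi k) * J r).tendsto 1).mono_left nhdsWithin_le_nhds
    have t2 : Tendsto K (𝓝[<] 1) (𝓝 (K 1)) := (hKc.tendsto 1).mono_left nhdsWithin_le_nhds
    refine tendsto_nhds_unique_of_eventuallyEq t1 t2 ?_
    filter_upwards [Ioo_mem_nhdsLT zero_lt_one] with r hr using hgreen r hr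
  have hA1 : ∀ y, A 1 y = y := fun y => by simp [hA]
  have hK1 : K 1 = 0 := by
    refine Finset.sum_eq_zero fun i _ => ?_
    have hface : ∀ b : ℝ, b = lo i ∨ b = hi i → ∀ x : Fin n → ℝ,
        v (A 1 (i.insertNth b x)) = 0 := by
      intro b hb x
      rw [hA1]
      refine hu0 _ fun hmem => ?_
      have := hmem i
      simp only [Fin.insertNth_apply_same] at this
      rcases hb with rfl | rfl
      · exact lt_irrefl _ this.1
      · exact lt_irrefl _ this.2
    simp [hface _ (Or.inl rfl), hface _ (Or.inr rfl)]
  rw [hK1, one_pow, one_mul] at hone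
  simpa only [hJ, hA1] using hone

/-! ### The Dirichlet spectrum of a box -/

section
variable {n : ℕ} {lo hi : Fin (n + 1) → ℝ}

/-- The sine product extended by zero outside of the box. -/
noncomputable def sineEigenfunction (lo hi : Fin (n + 1) → ℝ) (k : Fin (n + 1) → ℕ)
    (x : EuclideanSpace ℝ (Fin (n + 1))) : ℝ :=
  sinProd lo hi k fun i => max (lo i) (min (x i) (hi i))

theorem sineEigenfunction_eq (k : Fin (n + 1) → ℕ) {x : EuclideanSpace ℝ (Fin (n + 1))}
    (hx : ∀ i, x i ∈ Icc (lo i) (hi i)) :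
    sineEigenfunction lo hi k x = sinProd lo hi k (WithLp.ofLp x) := by
  rw [sineEigenfunction]
  congr 1
  ext i
  rw [min_eq_left (hx i).2, max_eq_right (hx i).1]

theorem isOpen_openBox (lo hi : Fin (n + 1) → ℝ) : IsOpen (openBox lo hi) := by
  have : openBox lo hi = ⋂ i, {x | x i ∈ Ioo (lo i) (hi i)} := by
    ext x; simp [openBox]
  rw [this]
  exact isOpen_iInter_of_finite fun i => isOpen_Ioo.preimage (by fun_prop)

/-- Clamping the coordinates sends every point outside the open box to a face, where the sine
product vanishes; continuity of the extension by zero is then automatic. -/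
theorem sineEigenfunction_mem (h : ∀ i, lo i < hi i) (k : Fin (n + 1) → ℕ) :
    sineEigenfunction lo hi k ∈ dirichletEigenspace (openBox lo hi) (boxEigenvalue lo hi k) := by
  refine ⟨?_, fun x hx => ?_, fun x hx => ?_⟩
  · exact (continuous_sinProd lo hi k).comp (by fun_prop)
  · obtain ⟨i, hxi⟩ := not_forall.1 hx
    refine sinProd_eq_zero_of_face h k (i := i) ?_
    rcases le_or_gt (x i) (lo i) with h1 | h1
    · left
      exact max_eq_left ((min_le_left _ _).trans h1)
    · have h2 : hi i ≤ x i := not_lt.1 fun h2 => hxi ⟨h1, h2⟩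
      right
      rw [min_eq_right h2, max_eq_right (h i).le]
  · have heq : sineEigenfunction lo hi k =ᶠ[𝓝 x] fun x => sinProd lo hi k (WithLp.ofLp x) := by
      filter_upwards [(isOpen_openBox lo hi).mem_nhds hx] with z hz
      exact sineEigenfunction_eq k fun i => Ioo_subset_Icc_self (hz i)
    have hsm : ContDiff ℝ 2 fun x : EuclideanSpace ℝ (Fin (n + 1)) =>
        sinProd lo hi k (WithLp.ofLp x) :=
      (contDiff_sinProd lo hi k).comp (PiLp.contDiff_ofLp (p := 2))
    refine ⟨hsm.contDiffAt.congr_of_eventuallyEq heq, ?_⟩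
    rw [(InnerProductSpace.laplacian_congr_nhds heq).eq_of_nhds, heq.eq_of_nhds]
    have := laplacian_eq_sum_partialD (y := WithLp.ofLp x) hsm.contDiffAt
    rw [WithLp.toLp_ofLp] at this
    rw [this]
    change -∑ i, partialD i (partialD i (sinProd lo hi k)) (WithLp.ofLp x) = _
    rw [sum_partialD_sinProd]
    ring

theorem integral_sineEigenfunction_mul (h : ∀ i, lo i < hi i) (k m : Fin (n + 1) → ℕ+) :
    ∫ y in Icc lo hi, sineEigenfunction lo hi (fun i => k i) (WithLp.toLp 2 y) *
      sinProd lo hi (fun i => m i) y = if k = m then ∏ i, (hi i - lo i) / 2 else 0 := by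
  rw [← integral_sinProd_mul h k m]
  refine setIntegral_congr_fun measurableSet_Icc fun y hy => ?_
  rw [sineEigenfunction_eq _ fun i => ⟨hy.1 i, hy.2 i⟩]

/-- Finiteness ensures that the space of all functions on the index set has dimension equal to its
cardinality. -/
theorem finite_boxEigenvalue_eq (h : ∀ i, lo i < hi i) (c : ℝ) :
    Finite {k : Fin (n + 1) → ℕ+ // boxEigenvalue lo hi (fun i => k i) = c} := by
  have hpi := Real.pi_pos
  have hex : ∀ i, ∃ N : ℕ+, ∀ m : ℕ+, (Real.pi * (m : ℕ) / (hi i - lo i)) ^ 2 ≤ c → m ≤ N := by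
    intro i
    have hw : 0 < hi i - lo i := sub_pos.2 (h i)
    obtain ⟨N, hN⟩ := exists_nat_ge (√c * (hi i - lo i) / Real.pi)
    refine ⟨⟨N + 1, N.succ_pos⟩, fun m hm => ?_⟩
    have h1 : Real.pi * (m : ℕ) / (hi i - lo i) ≤ √c := Real.le_sqrt_of_sq_le hm
    rw [div_le_iff₀ hw] at h1
    have h2 : ((m : ℕ) : ℝ) ≤ N := by
      refine le_trans ?_ hN
      rw [le_div_iff₀ hpi]
      linarith
    have h3 : (m : ℕ) ≤ N := by exact_mod_cast h2
    exact PNat.coe_le_coe _ _ |>.1 (h3.trans N.le_succ)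
  choose N hN using hex
  refine Set.Finite.to_subtype (s := {k : Fin (n + 1) → ℕ+ |
    boxEigenvalue lo hi (fun i => k i) = c}) ((finite_Icc (fun _ => 1) N).subset fun k hk => ?_)
  refine ⟨fun i => one_le, fun i => hN i _ ?_⟩
  have hk : boxEigenvalue lo hi (fun i => k i) = c := hk
  rw [← hk]
  exact Finset.single_le_sum (f := fun i => (Real.pi * ((k i : ℕ) : ℝ) / (hi i - lo i)) ^ 2)
    (fun _ _ => sq_nonneg _) (Finset.mem_univ i)

/-- The multiplicity of a Dirichlet eigenvalue of a box. -/
theorem rank_dirichletEigenspace_openBox (h : ∀ i, lo i < hi i) (c : ℝ) :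
    Module.rank ℝ (dirichletEigenspace (openBox lo hi) c) =
      Cardinal.mk {k : Fin (n + 1) → ℕ+ // boxEigenvalue lo hi (fun i => k i) = c} := by
  set S := {k : Fin (n + 1) → ℕ+ // boxEigenvalue lo hi (fun i => k i) = c} with hS
  have := finite_boxEigenvalue_eq h c
  have := Fintype.ofFinite S
  have hcont : ∀ u ∈ dirichletEigenspace (openBox lo hi) c,
      Continuous fun y : Fin (n + 1) → ℝ => u (WithLp.toLp 2 y) :=
    fun u hu => hu.1.comp (PiLp.continuous_toLp 2 _)
  have hint : ∀ u ∈ dirichletEigenspace (openBox lo hi) c, ∀ k, IntegrableOn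
      (fun y : Fin (n + 1) → ℝ => u (WithLp.toLp 2 y) * sinProd lo hi k y) (Icc lo hi) :=
    fun u hu k => ((hcont u hu).mul (continuous_sinProd lo hi k)).continuousOn.integrableOn_compact
      isCompact_Icc
  -- The sine coefficients whose eigenvalue is `c`. All others vanish by Green's identity, so
  -- completeness gives injectivity; orthogonality of the sine eigenfunctions gives surjectivity.
  let Φ : dirichletEigenspace (openBox lo hi) c →ₗ[ℝ] (S → ℝ) :=
    { toFun := fun u s => ∫ y in Icc lo hi,
        u.1 (WithLp.toLp 2 y) * sinProd lo hi (fun i => s.1 i) y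
      map_add' := fun u v => by
        ext s
        simp only [Submodule.coe_add, Pi.add_apply, add_mul]
        exact integral_add (hint u.1 u.2 _) (hint v.1 v.2 _)
      map_smul' := fun r u => by
        ext s
        simp only [Submodule.coe_smul, Pi.smul_apply, smul_eq_mul, mul_assoc, RingHom.id_apply]
        exact integral_const_mul _ _ }
  have hΦ : ∀ u s, Φ u s = ∫ y in Icc lo hi,
      u.1 (WithLp.toLp 2 y) * sinProd lo hi (fun i => s.1 i) y := fun _ _ => rfl
  have hinj : Function.Injective Φ := by
    rw [← LinearMap.ker_eq_bot, LinearMap.ker_eq_bot']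
    intro u hu
    ext x
    by_cases hx : x ∈ openBox lo hi
    · refine eq_zero_of_integral_sinProd_eq_zero h (hcont u.1 u.2) (fun k => ?_)
        (y := WithLp.ofLp x) hx
      by_cases hk : boxEigenvalue lo hi (fun i => k i) = c
      · exact congr_fun hu ⟨k, hk⟩
      · exact (mul_eq_zero.1 (integral_eigenfunction_mul_sinProd h u.2 _)).resolve_left
          (sub_ne_zero.2 (Ne.symm hk))
    · exact u.2.2.1 x hx
  have hsurj : Function.Surjective Φ := by
    rw [← LinearMap.range_eq_top, eq_top_iff]
    have hN : ∏ i, (hi i - lo i) / 2 ≠ 0 :=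
      Finset.prod_ne_zero_iff.2 fun i _ => (half_pos (sub_pos.2 (h i))).ne'
    intro f _
    have hf : f = ∑ s : S, (f s / ∏ i, (hi i - lo i) / 2) •
        Φ ⟨sineEigenfunction lo hi (fun i => s.1 i), by
          have := sineEigenfunction_mem h (fun i => (s.1 i : ℕ))
          rwa [s.2] at this⟩ := by
      ext s
      rw [Finset.sum_apply, Finset.sum_eq_single s]
      · rw [Pi.smul_apply, hΦ, smul_eq_mul, integral_sineEigenfunction_mul h, if_pos rfl, div_mul_cancel₀ _ hN]
      · intro t _ hts
        rw [Pi.smul_apply, hΦ, smul_eq_mul, integral_sineEigenfunction_mul h, if_neg fun he => hts (Subtype.ext he), mul_zero]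
      · simp
    rw [hf]
    exact Submodule.sum_mem _ fun s _ => Submodule.smul_mem _ _ ⟨_, rfl⟩
  rw [(LinearEquiv.ofBijective Φ ⟨hinj, hsurj⟩).rank_eq, rank_fun', Cardinal.mk_fintype]

end

/-- Two families whose values have the same multiplicities agree up to a bijection. -/
theorem exists_equiv_of_mk_fiber_eq {α β γ : Type} {f : α → γ} {g : β → γ}
    (h : ∀ c, Cardinal.mk {a // f a = c} = Cardinal.mk {b // g b = c}) :
    ∃ e : α ≃ β, ∀ a, f a = g (e a) := by
  have he := fun c => (Cardinal.eq.1 (h c)).some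
  refine ⟨(Equiv.sigmaFiberEquiv f).symm.trans ((Equiv.sigmaCongrRight he).trans
    (Equiv.sigmaFiberEquiv g)), fun a => ?_⟩
  exact ((he (f a)) ⟨a, rfl⟩).2.symm

theorem chamber_eq_openBox (p q L₂ L₃ : ℝ) :
    chamber p q L₂ L₃ = openBox ![p, 0, 0] ![q, L₂, L₃] := by
  ext x
  simp [chamber, openBox, Fin.forall_fin_succ]

/-- Triples as functions on `Fin 3`. -/
def tripleEquiv : (Fin 3 → ℕ+) ≃ ℕ+ × ℕ+ × ℕ+ where
  toFun k := (k 0, k 1, k 2)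
  invFun l := ![l.1, l.2.1, l.2.2]
  left_inv k := by ext i; fin_cases i <;> rfl
  right_inv l := rfl

theorem boxEig_tripleEquiv (p q L₂ L₃ : ℝ) (k : Fin 3 → ℕ+) :
    boxEig (q - p) L₂ L₃ (tripleEquiv k) =
      boxEigenvalue ![p, 0, 0] ![q, L₂, L₃] (fun i => k i) := by
  have h : tripleEquiv k = (k 0, k 1, k 2) := rfl
  simp [boxEig, boxEigenvalue, h, Fin.sum_univ_three, add_assoc]

/-- Equal multiplicities for every value amount to a reindexing, so any admissible list of
eigenvalues is an enumeration of the explicit lattice family. -/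
theorem isDirichletSpectrum_chamber_iff {p q L₂ L₃ : ℝ} (hpq : p < q) (h₂ : 0 < L₂) (h₃ : 0 < L₃)
    (lam : ℕ → ℝ) : IsDirichletSpectrum (chamber p q L₂ L₃) lam ↔
      ∃ e : ℕ ≃ ℕ+ × ℕ+ × ℕ+, ∀ j, lam j = boxEig (q - p) L₂ L₃ (e j) := by
  have h : ∀ i, (![p, 0, 0] : Fin 3 → ℝ) i < (![q, L₂, L₃] : Fin 3 → ℝ) i := by
    intro i; fin_cases i <;> simpa
  have hr : ∀ c, Module.rank ℝ (dirichletEigenspace (chamber p q L₂ L₃) c) =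
      Cardinal.mk {l : ℕ+ × ℕ+ × ℕ+ // boxEig (q - p) L₂ L₃ l = c} := by
    intro c
    rw [chamber_eq_openBox, rank_dirichletEigenspace_openBox h]
    exact Cardinal.mk_congr (tripleEquiv.subtypeEquiv fun k => by rw [boxEig_tripleEquiv])
  simp only [IsDirichletSpectrum, hr]
  constructor
  · exact fun hc => exists_equiv_of_mk_fiber_eq fun c => (hc c).symm
  · rintro ⟨e, he⟩ c
    exact (Cardinal.mk_congr (e.subtypeEquiv fun j => by rw [he])).symm

/-! ### The Casimir energy of a chamber -/

theorem tendsto_zeta_chamber {p q L₂ L₃ : ℝ} (hpq : p < q) (h₂ : 0 < L₂) (h₃ : 0 < L₃) {E : ℂ}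
    {W : ℂ → ℂ} (hW : Meromorphic W)
    (hWs : ∀ s : ℂ, 3 < s.re → HasSum (fun l => (boxEig (q - p) L₂ L₃ l : ℂ) ^ (-s)) (W s))
    (hWE : Tendsto W (𝓝[≠] (-1 / 2)) (𝓝 E)) {lam : ℕ → ℝ} {Z : ℂ → ℂ}
    (hZ : IsZetaContinuation lam Z) (hlam : IsDirichletSpectrum (chamber p q L₂ L₃) lam) :
    Tendsto Z (𝓝[≠] (-1 / 2)) (𝓝 E) := by
  obtain ⟨e, he⟩ := (isDirichletSpectrum_chamber_iff hpq h₂ h₃ lam).1 hlam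
  have hW' : IsZetaContinuation lam W := by
    refine ⟨hW, 3, fun s hs => ?_⟩
    simp_rw [he]
    exact e.hasSum_iff.2 (hWs s hs)
  exact hWE.congr' (hW'.eventuallyEq hZ _)

theorem isCasimirEnergy_chamber_iff {p q L₂ L₃ : ℝ} (hpq : p < q) (h₂ : 0 < L₂) (h₃ : 0 < L₃)
    {E : ℝ} {W : ℂ → ℂ} (hW : Meromorphic W)
    (hWs : ∀ s : ℂ, 3 < s.re → HasSum (fun l => (boxEig (q - p) L₂ L₃ l : ℂ) ^ (-s)) (W s))
    (hWE : Tendsto W (𝓝[≠] (-1 / 2)) (𝓝 (2 * (E : ℂ)))) (m e : ℝ) :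
    IsCasimirEnergy (chamber p q L₂ L₃) m e ↔ e = E := by
  -- Index `4` stands for `a_2`; the box expansion ends at index `3`, so the logarithm of the scale
  -- `m` gets coefficient zero.
  have ha : boxHeatCoeff (q - p) L₂ L₃ (3 + 1) = 0 := by simp [boxHeatCoeff]
  constructor
  · rintro ⟨lam, Z, R, FP, a, hlam, hZ, hFP, hheat, hE⟩
    obtain ⟨f, hf⟩ := (isDirichletSpectrum_chamber_iff hpq h₂ h₃ lam).1 hlam
    have h1 := hFP.eq_of_tendsto (tendsto_zeta_chamber hpq h₂ h₃ hW hWs hWE hZ hlam)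
    have h2 := hheat.unique (isHeatExpansion_box (sub_pos.2 hpq) h₂ h₃ f hf)
    rw [h1, h2, ha, mul_zero, zero_mul, Complex.ofReal_zero, sub_zero,
      mul_div_cancel_left₀ _ two_ne_zero] at hE
    exact_mod_cast hE
  · rintro rfl
    obtain ⟨f⟩ : Nonempty (ℕ ≃ ℕ+ × ℕ+ × ℕ+) := ⟨(Denumerable.eqv (ℕ+ × ℕ+ × ℕ+)).symm⟩
    refine ⟨fun j => boxEig (q - p) L₂ L₃ (f j), W, 0, 2 * (e : ℂ), boxHeatCoeff (q - p) L₂ L₃,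
      (isDirichletSpectrum_chamber_iff hpq h₂ h₃ _).2 ⟨f, fun _ => rfl⟩,
      ⟨hW, 3, fun s hs => f.hasSum_iff.2 (hWs s hs)⟩, ?_,
      isHeatExpansion_box (sub_pos.2 hpq) h₂ h₃ f fun _ => rfl, ?_⟩
    · simpa [HasResidueFinitePart] using hWE
    · rw [ha, mul_zero, zero_mul, Complex.ofReal_zero, sub_zero,
        mul_div_cancel_left₀ _ two_ne_zero]

theorem deriv_besselSum_term {L₂ L₃ : ℝ} (h₂ : 0 < L₂) (l : ℕ+ × ℕ+ × ℕ+) {x : ℝ} (hx : 0 < x) :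
    |crossMu L₂ L₃ l.2.1 l.2.2 / (l.1 : ℝ)| *
      deriv (fun x : ℝ => besselK 1 (2 * x * l.1 * crossMu L₂ L₃ l.2.1 l.2.2)) x =
    -(1 / 2) * (crossMu L₂ L₃ l.2.1 l.2.2 ^ 2 *
      besselInt 1 (2 * x * l.1 * crossMu L₂ L₃ l.2.1 l.2.2)) := by
  rw [(hasDerivAt_besselSum_term h₂ l hx).deriv, mul_left_comm, abs_mul_besselSum_term h₂]

theorem deriv_besselSum_term_reflect {L₂ L₃ L : ℝ} (h₂ : 0 < L₂) (l : ℕ+ × ℕ+ × ℕ+) {x : ℝ}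
    (hx : 0 < L - x) :
    |crossMu L₂ L₃ l.2.1 l.2.2 / (l.1 : ℝ)| *
      deriv (fun x : ℝ => besselK 1 (2 * (L - x) * l.1 * crossMu L₂ L₃ l.2.1 l.2.2)) x =
    1 / 2 * (crossMu L₂ L₃ l.2.1 l.2.2 ^ 2 *
      besselInt 1 (2 * (L - x) * l.1 * crossMu L₂ L₃ l.2.1 l.2.2)) := by
  have h := (hasDerivAt_besselSum_term (L₃ := L₃) h₂ l hx).comp x
    ((hasDerivAt_id x).const_sub L)
  rw [show (fun x : ℝ => besselK 1 (2 * (L - x) * l.1 * crossMu L₂ L₃ l.2.1 l.2.2)) =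
    (fun x : ℝ => besselK 1 (2 * x * l.1 * crossMu L₂ L₃ l.2.1 l.2.2)) ∘ fun x => L - x from rfl]
  have h' := abs_mul_besselSum_term (L₃ := L₃) h₂ l
    (besselInt 1 (2 * (L - x) * l.1 * crossMu L₂ L₃ l.2.1 l.2.2))
  refine (congr_arg _ h.deriv).trans ?_
  rw [← h']
  ring

theorem mainTheorem8 (L L₂ L₃ : ℝ) (hL : 0 < L) (hL₂ : 0 < L₂) (hL₃ : 0 < L₃) :
    DifferentiableOn ℝ (besselK 1) (Ioi 0) ∧ StrictAntiOn (besselK 1) (Ioi 0) ∧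
    -- `El x`, `Er x`: Casimir energies of the left and the right chamber for the piston at `x`,
    -- `F x`: total force on the piston
    ∃ El Er F : ℝ → ℝ,
      -- the energies exist, are unique, and do not depend on the scale `m`
      (∀ x ∈ Ioo 0 L, ∀ m : ℝ, 0 < m → ∀ e : ℝ,
        (IsCasimirEnergy (chamber 0 x L₂ L₃) m e ↔ e = El x) ∧
        (IsCasimirEnergy (chamber x L L₂ L₃) m e ↔ e = Er x)) ∧
      -- the zeta functions of the chambers have no pole at `-1/2`, and the energy is `ζ(-1/2) / 2`
      (∀ x ∈ Ioo 0 L, ∀ (lam : ℕ → ℝ) (Z : ℂ → ℂ), IsZetaContinuation lam Z →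
        (IsDirichletSpectrum (chamber 0 x L₂ L₃) lam →
          Tendsto Z (𝓝[≠] (-1 / 2)) (𝓝 (2 * (El x : ℂ)))) ∧
        (IsDirichletSpectrum (chamber x L L₂ L₃) lam →
          Tendsto Z (𝓝[≠] (-1 / 2)) (𝓝 (2 * (Er x : ℂ))))) ∧
      ∀ L₁ ∈ Ioo 0 L,
        HasDerivAt (fun x => -(El x + Er x)) (F L₁) L₁ ∧
        Summable (fun l : ℕ+ × ℕ+ × ℕ+ => |crossMu L₂ L₃ l.2.1 l.2.2 / (l.1 : ℝ)| *
          deriv (fun x : ℝ => besselK 1 (2 * x * l.1 * crossMu L₂ L₃ l.2.1 l.2.2)) L₁) ∧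
        Summable (fun l : ℕ+ × ℕ+ × ℕ+ => |crossMu L₂ L₃ l.2.1 l.2.2 / (l.1 : ℝ)| *
          deriv (fun x : ℝ => besselK 1 (2 * (L - x) * l.1 * crossMu L₂ L₃ l.2.1 l.2.2)) L₁) ∧
        F L₁ =
          1 / (2 * Real.pi) * (∑' l : ℕ+ × ℕ+ × ℕ+, |crossMu L₂ L₃ l.2.1 l.2.2 / (l.1 : ℝ)| *
            deriv (fun x : ℝ => besselK 1 (2 * x * l.1 * crossMu L₂ L₃ l.2.1 l.2.2)) L₁) +
          1 / (2 * Real.pi) * (∑' l : ℕ+ × ℕ+ × ℕ+, |crossMu L₂ L₃ l.2.1 l.2.2 / (l.1 : ℝ)| *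
            deriv (fun x : ℝ =>
              besselK 1 (2 * (L - x) * l.1 * crossMu L₂ L₃ l.2.1 l.2.2)) L₁) ∧
        -- attraction to the closer wall: the walls are at `0` and `L`
        (L₁ < L - L₁ → F L₁ < 0) ∧ (L - L₁ < L₁ → 0 < F L₁) := by
  obtain ⟨α, β, hE⟩ := exists_zeta_box hL₂ hL₃
  set E : ℝ → ℝ := fun a => α * a + β - 1 / (2 * Real.pi) * besselSum L₂ L₃ a with hEdef
  have hpi := Real.pi_pos
  refine ⟨fun z hz => (hasDerivAt_besselK_one hz).differentiableAt.differentiableWithinAt,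
    strictAntiOn_besselK_one, E, fun x => E (L - x),
    fun x => -(1 / (4 * Real.pi)) * besselSumDeriv L₂ L₃ x +
      1 / (4 * Real.pi) * besselSumDeriv L₂ L₃ (L - x),
    fun x hx m _ e => ?_, fun x hx lam Z hZ => ?_, fun x hx => ?_⟩
  · obtain ⟨W, hW, hWs, hWE⟩ := hE x hx.1
    obtain ⟨V, hV, hVs, hVE⟩ := hE (L - x) (sub_pos.2 hx.2)
    exact ⟨isCasimirEnergy_chamber_iff hx.1 hL₂ hL₃ hW (by simpa using hWs) hWE m e,
      isCasimirEnergy_chamber_iff hx.2 hL₂ hL₃ hV hVs hVE m e⟩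
  · obtain ⟨W, hW, hWs, hWE⟩ := hE x hx.1
    obtain ⟨V, hV, hVs, hVE⟩ := hE (L - x) (sub_pos.2 hx.2)
    exact ⟨tendsto_zeta_chamber hx.1 hL₂ hL₃ hW (by simpa using hWs) hWE hZ,
      tendsto_zeta_chamber hx.2 hL₂ hL₃ hV hVs hVE hZ⟩
  · have hx0 : 0 < x := hx.1
    have hxL : 0 < L - x := sub_pos.2 hx.2
    have hEd : ∀ a, 0 < a →
        HasDerivAt E (α + 1 / (4 * Real.pi) * besselSumDeriv L₂ L₃ a) a := by
      intro a ha
      refine ((((hasDerivAt_id a).const_mul α).add_const β).sub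
        ((hasDerivAt_besselSum hL₂ hL₃ ha).const_mul (1 / (2 * Real.pi)))).congr_deriv ?_
      field_simp
      ring
    have t1 := fun l => deriv_besselSum_term (L₃ := L₃) hL₂ l hx0
    have t2 := fun l => deriv_besselSum_term_reflect (L₃ := L₃) hL₂ l hxL
    simp only [t1, t2]
    refine ⟨?_, (summable_besselInt_one hL₂ hL₃ hx0).mul_left _,
      (summable_besselInt_one hL₂ hL₃ hxL).mul_left _, ?_, fun hlt => ?_, fun hlt => ?_⟩
    -- The inner derivative `-1` of `L - x` makes the two contributions `α` cancel.
    · refine ((hEd x hx0).add ((hEd (L - x) hxL).comp x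
        ((hasDerivAt_id x).const_sub L))).neg.congr_deriv ?_
      ring
    · rw [tsum_mul_left, tsum_mul_left]
      change _ = 1 / (2 * Real.pi) * (-(1 / 2) * besselSumDeriv L₂ L₃ x) +
        1 / (2 * Real.pi) * (1 / 2 * besselSumDeriv L₂ L₃ (L - x))
      field_simp
      ring
    -- The force is `1/(4π)` times `besselSumDeriv` at `L - x` minus its value at `x`, so strict
    -- monotonicity decides the sign.
    · have h := strictAntiOn_besselSumDeriv hL₂ hL₃ hx0 hxL hlt
      have := mul_lt_mul_of_pos_left h (show 0 < 1 / (4 * Real.pi) by positivity)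
      linarith
    · have h := strictAntiOn_besselSumDeriv hL₂ hL₃ hxL hx0 hlt
      have := mul_lt_mul_of_pos_left h (show 0 < 1 / (4 * Real.pi) by positivity)
      linarith
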